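/- Let $N\in\mathbb N$, let $(e_n)_{n=1}^N$ be an orthonormal basis of $\mathbb R^N$, and let $A$ and $Q$ be the linear operators on $\mathbb R^N$ with $Ae_n=-\lambda_n e_n$ and $Qe_n=\sigma_n^2e_n$, where $\lambda_n>0$ and $\sigma_n\ge 0$ for $n=1,\dots,N$; let $\sqrt Q\,e_n=\sigma_ne_n$. Let $\beta^1,\dots,\beta^N$ be independent real Brownian motions on a probability space $(\Omega,\mathcal F,\mathbb P)$ and $W^N=\sum_{n=1}^N\beta^ne_n$. Let $\ell\colon[0,\infty)\to[0,\infty)$ be a (deterministic) increasing, not necessarily strictly increasing, càdlàg function with $\ell_0=0$ and $\ell_t>0$ for $t>0$. All integrals from $0$ to $t$ with respect to $d\ell_s$ and $d\beta^n_{\ell_s}$ are over $(0,t]$; the stochastic integral $\int_0^tf(s)\,d\beta^n_{\ell_s}$ of a continuous deterministic $f$ is the limit in probability of the sums $\sum_i f(u_i)(\beta^n_{\ell_{u_{i+1}}}-\beta^n_{\ell_{u_i}})$ as the mesh of the partition $0=u_0\le\dots\le u_m=t$ tends to $0$. For every $x\in\mathbb R^N$ the linear SDE $$dZ^\ell_t(x)=AZ^\ell_t(x)\,dt+\sqrt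 Q\,dW^N_{\ell_t},\qquad Z^\ell_0(x)=x,$$ has a càdlàg solution, unique up to indistinguishability, and the stochastic integrals $\int_0^te^{-\lambda_n(t-s)}d\beta^n_{\ell_s}$ exist. For all $t\ge0$ and $x\in\mathbb R^N$, $$Z^\ell_t(x)=e^{tA}x+\int_0^te^{(t-s)A}\sqrt Q\,dW^N_{\ell_s}=e^{tA}x+\sum_{n=1}^N\sigma_n\Big(\int_0^te^{-\lambda_n(t-s)}d\beta^n_{\ell_s}\Big)e_n\quad\mathbb P\text{-a.s.},$$ and $$Z^\ell_t(x)\sim\mathcal N\Big(e^{tA}x,\int_0^te^{2A(t-s)}Q\,d\ell_s\Big),$$ the covariance integral being taken entrywise. Suppose moreover that $\sigma_n>0$ for $n=1,\dots,N$. Then for every $t>0$ and every bounded Borel function $\phi\colon\mathbb R^N\to\mathbb R$, the function $x\mapsto\mathbb E[\phi(Z^\ell_t(x))]$ is differentiable at every $x\in\mathbb R^N$, and for every $h\in\mathbb R^N$ $$\big\langle\nabla\mathbb E[\phi(Z^\ell_t(x))],h\big\rangle=\mathbb E\left[\phi(Z^\ell_t(x))\left(\sum_{n=1}^N\frac1{\sigma_n}\,\frac{e^{-\lambda_nt}\langle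 h,e_n\rangle}{\int_0^te^{-2\lambda_n(t-s)}d\ell_s}\int_0^te^{-\lambda_n(t-s)}d\beta^n_{\ell_s}\right)\right],$$ where the random variable on the right is integrable. -/

import Mathlib

open MeasureTheory ProbabilityTheory Set Filter
open scoped NNReal ENNReal Topology

noncomputable section

/-- Right-continuous with left limits at every time of `[0, ∞)`
(the left-limit condition at time `0` is void, since `𝓝[<] 0 = ⊥` in `ℝ≥0`). -/
def IsCadlag {F : Type*} [TopologicalSpace F] (f : ℝ≥0 → F) : Prop :=
  ∀ t, ContinuousWithinAt f (Ici t) t ∧ ∃ y, Tendsto f (𝓝[<] t) (𝓝 y)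

/-- Deterministic time changes: increasing (not necessarily strictly) càdlàg functions
`ℓ : [0, ∞) → [0, ∞)` with `ℓ 0 = 0` and `ℓ t > 0` for `t > 0`. -/
structure TimeChange where
  toFun : ℝ≥0 → ℝ≥0
  monotone' : Monotone toFun
  cadlag' : IsCadlag toFun
  map_zero' : toFun 0 = 0
  pos' : ∀ t, 0 < t → 0 < toFun t

instance : CoeFun TimeChange (fun _ => ℝ≥0 → ℝ≥0) := ⟨TimeChange.toFun⟩

/-- A time change as a Stieltjes function on `[0, ∞)`. -/
def TimeChange.stieltjes (ℓ : TimeChange) : StieltjesFunction ℝ≥0 where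
  toFun t := (ℓ t : ℝ)
  mono' := fun _ _ h => NNReal.coe_le_coe.2 (ℓ.monotone' h)
  right_continuous' := fun t =>
    NNReal.continuous_coe.continuousAt.comp_continuousWithinAt (ℓ.cadlag' t).1

/-- The Lebesgue-Stieltjes integral `∫_0^t g(s) dℓ_s`, over `(0, t]`. -/
def TimeChange.integral (ℓ : TimeChange) (g : ℝ≥0 → ℝ) (t : ℝ≥0) : ℝ :=
  ∫ s in Ioc 0 t, g s ∂ℓ.stieltjes.measure

/-- `X = (X_t)` is a càdlàg solution of `dX_t = A X_t dt + S dY_t`, `X_0 = x`, where the noise `Y`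
is additive: almost surely, the path is càdlàg and satisfies
`X_t = x + ∫_0^t A X_s ds + S (Y_t - Y_0)` for all `t ≥ 0`. -/
def IsOUSolution {Ω : Type*} [MeasurableSpace Ω] {N : ℕ} (P : Measure Ω)
    (A S : EuclideanSpace ℝ (Fin N) →L[ℝ] EuclideanSpace ℝ (Fin N))
    (Y : ℝ≥0 → Ω → EuclideanSpace ℝ (Fin N)) (x : EuclideanSpace ℝ (Fin N))
    (X : ℝ≥0 → Ω → EuclideanSpace ℝ (Fin N)) : Prop :=
  ∀ᵐ ω ∂P, IsCadlag (fun t => X t ω) ∧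
    ∀ t : ℝ≥0, X t ω = x + (∫ s in (0 : ℝ)..t, A (X s.toNNReal ω)) + S (Y t ω - Y 0 ω)

/-- `I` is the stochastic integral `∫_0^t f(s) dY_s` of the deterministic integrand `f` against the
càdlàg process `Y`: the left-point sums `∑ f(u_i) (Y_{u_{i+1}} - Y_{u_i})` converge to `I` in
probability as the mesh of the partition `0 = u_0 ≤ ⋯ ≤ u_m = t` tends to `0`. -/
def IsStochIntegral {Ω : Type*} [MeasurableSpace Ω] (P : Measure Ω)
    (f : ℝ≥0 → ℝ) (Y : ℝ≥0 → Ω → ℝ) (t : ℝ≥0) (I : Ω → ℝ) : Prop :=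
  AEMeasurable I P ∧
    ∀ ε : ℝ, 0 < ε → ∃ δ : ℝ, 0 < δ ∧ ∀ (m : ℕ) (u : ℕ → ℝ≥0),
      Monotone u → u 0 = 0 → u m = t → (∀ i < m, (u (i + 1) : ℝ) - u i ≤ δ) →
        P {ω | ε ≤ |(∑ i ∈ Finset.range m, f (u i) * (Y (u (i + 1)) ω - Y (u i) ω)) - I ω|}
          ≤ ENNReal.ofReal ε

open Classical in
/-- The stochastic integral `∫_0^t f(s) dY_s` (a version of it, as it is unique up to
almost sure equality); zero if the integral does not exist. -/
def stochIntegral {Ω : Type*} [MeasurableSpace Ω] (P : Measure Ω)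
    (f : ℝ≥0 → ℝ) (Y : ℝ≥0 → Ω → ℝ) (t : ℝ≥0) : Ω → ℝ :=
  if h : ∃ I, IsStochIntegral P f Y t I then h.choose else 0

/-- The covariance matrix `∫_0^t e^{2 (t - s) A} Q dℓ_s`, the integral being taken entrywise. -/
def ouCovariance {N : ℕ} (A Q : EuclideanSpace ℝ (Fin N) →L[ℝ] EuclideanSpace ℝ (Fin N))
    (ℓ : TimeChange) (t : ℝ≥0) : Matrix (Fin N) (Fin N) ℝ :=
  Matrix.of fun i j => ℓ.integral (fun s =>
    (Matrix.toEuclideanCLM (n := Fin N) (𝕜 := ℝ)).symm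
      (NormedSpace.exp ((2 * ((t : ℝ) - s)) • A) * Q) i j) t

end

/-!
The noise enters additively, so path by path the equation is a linear ODE with càdlàg forcing. It
is solved by variation of constants, an integration by parts moving the differential from the noise
onto the exponential; differences of solutions solve a homogeneous integral equation, so Grönwall's
inequality gives uniqueness. In the same way, summation by parts turns the Riemann sums of a `C¹`
integrand into Lebesgue integrals of the càdlàg path, which converge pathwise, and the limits are
exactly the coefficients in the variation of constants formula.

The increments of time-changed independent Brownian motions are independent centred Gaussians with
variances given by the increments of `ℓ`, so the integrals are independent centred Gaussians of
variance `∫ f² dℓ`.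

If no `σ n` vanishes, moving the starting point amounts to a translation of this Gaussian vector.
The Cameron–Martin formula transfers the translation to an exponential density, which is smooth in
the starting point, so one can differentiate under the expectation however irregular `φ` is.
-/

/-! ### Càdlàg paths -/

namespace IsCadlag

section TopologicalSpace

variable {F G : Type*} [TopologicalSpace F] [TopologicalSpace G] {f g : ℝ≥0 → F}

lemma of_continuous (hf : Continuous f) : IsCadlag f := fun t =>
  ⟨hf.continuousWithinAt, f t, (hf.tendsto t).mono_left nhdsWithin_le_nhds⟩

lemma continuous_comp (hf : IsCadlag f) {φ : F → G} (hφ : Continuous φ) :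
    IsCadlag (fun t => φ (f t)) := fun t =>
  ⟨hφ.continuousAt.comp_continuousWithinAt (hf t).1,
    let ⟨y, hy⟩ := (hf t).2; ⟨φ y, (hφ.tendsto y).comp hy⟩⟩

lemma add [Add F] [ContinuousAdd F] (hf : IsCadlag f) (hg : IsCadlag g) :
    IsCadlag (fun t => f t + g t) := fun t =>
  ⟨(hf t).1.add (hg t).1,
    let ⟨y, hy⟩ := (hf t).2; let ⟨z, hz⟩ := (hg t).2; ⟨y + z, hy.add hz⟩⟩

lemma sum {ι : Type*} [AddCommMonoid F] [ContinuousAdd F] {f : ι → ℝ≥0 → F} (s : Finset ι)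
    (hf : ∀ i ∈ s, IsCadlag (f i)) : IsCadlag (fun t => ∑ i ∈ s, f i t) := fun t => by
  choose! y hy using fun i hi => (hf i hi t).2
  exact ⟨tendsto_finsetSum _ fun i hi => (hf i hi t).1,
    ∑ i ∈ s, y i, tendsto_finsetSum _ fun i hi => hy i hi⟩

lemma continuousWithinAt_toNNReal (hf : IsCadlag f) (s : ℝ) :
    ContinuousWithinAt (fun s : ℝ => f s.toNNReal) (Ici s) s :=
  (hf s.toNNReal).1.comp continuous_real_toNNReal.continuousWithinAt
    fun _ h => Real.toNNReal_le_toNNReal h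

/-- The path is the limit of its values at the points of the grid `ℕ / (n + 1)` to the right. -/
lemma stronglyMeasurable [TopologicalSpace.PseudoMetrizableSpace F] (hf : IsCadlag f) :
    StronglyMeasurable f := by
  let next : ℕ → ℝ≥0 → ℝ≥0 := fun n s => (⌊s * (n + 1)⌋₊ + 1 : ℝ≥0) / (n + 1)
  have le_next n s : s ≤ next n s := by
    rw [le_div_iff₀ (by positivity)]
    exact (Nat.lt_floor_add_one _).le
  have next_le n s : next n s ≤ s + 1 / (n + 1) := by
    rw [div_le_iff₀ (by positivity), add_mul, one_div, inv_mul_cancel₀ (by positivity)]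
    gcongr
    exact Nat.floor_le zero_le
  have tendsto_next s : Tendsto (fun n => next n s) atTop (𝓝[≥] s) := by
    refine tendsto_nhdsWithin_iff.2 ⟨?_, Eventually.of_forall fun n => le_next n s⟩
    refine tendsto_of_tendsto_of_tendsto_of_le_of_le tendsto_const_nhds ?_
      (fun n => le_next n s) (fun n => next_le n s)
    simpa using (tendsto_one_div_add_atTop_nhds_zero_nat (𝕜 := ℝ≥0)).const_add s
  refine stronglyMeasurable_of_tendsto atTop (f := fun n s => f (next n s)) (fun n => ?_)
    (tendsto_pi_nhds.2 fun s => (hf s).1.tendsto.comp (tendsto_next s))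
  have : StronglyMeasurable fun k : ℕ => f ((k + 1 : ℝ≥0) / (n + 1)) := .of_discrete
  exact this.comp_measurable (Nat.measurable_floor.comp (by fun_prop))

end TopologicalSpace

section NormedSpace

variable {E : Type*} [NormedAddCommGroup E] {f : ℝ≥0 → E}

lemma exists_norm_le (hf : IsCadlag f) (t : ℝ≥0) : ∃ C : ℝ, ∀ s ≤ t, ‖f s‖ ≤ C := by
  have locally_bounded (s : ℝ≥0) : ∃ C : ℝ, ∀ᶠ r in 𝓝 s, ‖f r‖ ≤ C := by
    obtain ⟨y, hy⟩ := (hf s).2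
    have left : ∀ᶠ r in 𝓝[<] s, ‖f r‖ < ‖y‖ + 1 := hy.norm.eventually_lt_const (by linarith)
    have right : ∀ᶠ r in 𝓝[≥] s, ‖f r‖ < ‖f s‖ + 1 :=
      (hf s).1.norm.eventually_lt_const (by linarith)
    refine ⟨max (‖y‖ + 1) (‖f s‖ + 1), ?_⟩
    rw [← nhdsLT_sup_nhdsGE s, eventually_sup]
    exact ⟨left.mono fun r hr => hr.le.trans (le_max_left _ _),
      right.mono fun r hr => hr.le.trans (le_max_right _ _)⟩
  have bounded : ∃ C : ℝ, ∀ s ∈ Icc 0 t, ‖f s‖ ≤ C := by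
    refine isCompact_Icc.induction_on (p := fun S => ∃ C : ℝ, ∀ s ∈ S, ‖f s‖ ≤ C)
      ⟨0, by simp⟩ (fun S S' h ⟨C, hC⟩ => ⟨C, fun s hs => hC s (h hs)⟩) ?_ fun s _ => ?_
    · rintro S S' ⟨C, hC⟩ ⟨C', hC'⟩
      exact ⟨max C C', fun s hs => hs.elim (fun hs => (hC s hs).trans (le_max_left _ _))
        fun hs => (hC' s hs).trans (le_max_right _ _)⟩
    · obtain ⟨C, hC⟩ := locally_bounded s
      exact ⟨_, mem_nhdsWithin_of_mem_nhds hC, C, fun r hr => hr⟩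
  obtain ⟨C, hC⟩ := bounded
  exact ⟨C, fun s hs => hC s ⟨zero_le, hs⟩⟩

lemma intervalIntegrable (hf : IsCadlag f) (a b : ℝ) :
    IntervalIntegrable (fun s => f s.toNNReal) volume a b := by
  obtain ⟨C, hC⟩ := hf.exists_norm_le (max a b).toNNReal
  refine (intervalIntegrable_const (c := C)).mono_fun
    (hf.stronglyMeasurable.comp_measurable measurable_real_toNNReal).aestronglyMeasurable ?_
  refine (ae_restrict_iff' measurableSet_uIoc).2 (Eventually.of_forall fun s hs => ?_)
  exact (hC _ (Real.toNNReal_le_toNNReal hs.2)).trans (le_abs_self C)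

lemma intervalIntegrable_clm_apply {F : Type*} [NormedAddCommGroup F] [NormedSpace ℝ E]
    [NormedSpace ℝ F] (hf : IsCadlag f) {Φ : ℝ → E →L[ℝ] F} (hΦ : Continuous Φ) (a b : ℝ) :
    IntervalIntegrable (fun s => Φ s (f s.toNNReal)) volume a b := by
  obtain ⟨C, hC⟩ := hf.exists_norm_le (max a b).toNNReal
  have bound : IntervalIntegrable (fun s => ‖Φ s‖ * C) volume a b :=
    (hΦ.norm.mul continuous_const).intervalIntegrable a b
  refine bound.mono_fun ?_ ?_
  · exact (ContinuousLinearMap.apply ℝ F).flip.continuous₂.comp_aestronglyMeasurable₂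
      hΦ.aestronglyMeasurable
      (hf.stronglyMeasurable.comp_measurable measurable_real_toNNReal).aestronglyMeasurable
  · refine (ae_restrict_iff' measurableSet_uIoc).2 (Eventually.of_forall fun s hs => ?_)
    have := hC _ (Real.toNNReal_le_toNNReal hs.2)
    exact ((Φ s).le_opNorm_of_le this).trans (le_abs_self _)

end NormedSpace

end IsCadlag

/-! ### The linear equation in a Banach space driven by a càdlàg path -/

section MildPath

variable {E : Type*} [NormedAddCommGroup E] [NormedSpace ℝ E]

/-- The variation of constants formula for the solution of `z t = x + ∫ s in 0..t, A (z s) + g t`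
with càdlàg forcing `g`. The convolution of the semigroup with `g` is integrated by parts, so that
it involves the values of `g` but no integral against `dg`. -/
noncomputable def mildPath (A : E →L[ℝ] E) (x : E) (g : ℝ≥0 → E) (t : ℝ≥0) : E :=
  NormedSpace.exp ((t : ℝ) • A)
    (x + ∫ s in (0 : ℝ)..t, NormedSpace.exp (-s • A) (A (g s.toNNReal))) + g t

lemma IsCadlag.continuous_integral_clm_apply {f : ℝ≥0 → E} (hf : IsCadlag f)
    {Φ : ℝ → E →L[ℝ] E} (hΦ : Continuous Φ) :
    Continuous (fun t => ∫ s in (0 : ℝ)..t, Φ s (f s.toNNReal)) :=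
  intervalIntegral.continuous_primitive (hf.intervalIntegrable_clm_apply hΦ) 0

variable [CompleteSpace E] {A : E →L[ℝ] E} {x : E} {g : ℝ≥0 → E}

lemma IsCadlag.hasDerivWithinAt_integral_clm_apply {f : ℝ≥0 → E} (hf : IsCadlag f)
    {Φ : ℝ → E →L[ℝ] E} (hΦ : Continuous Φ) (t : ℝ) :
    HasDerivWithinAt (fun t => ∫ s in (0 : ℝ)..t, Φ s (f s.toNNReal)) (Φ t (f t.toNNReal))
      (Ici t) t := by
  have hmeas : StronglyMeasurableAtFilter (fun s => Φ s (f s.toNNReal)) (𝓝[>] t) :=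
    ⟨Ioc t (t + 1), Ioc_mem_nhdsGT (lt_add_one t),
      (hf.intervalIntegrable_clm_apply hΦ t (t + 1)).aestronglyMeasurable⟩
  exact intervalIntegral.integral_hasDerivWithinAt_right
    (hf.intervalIntegrable_clm_apply hΦ 0 t) hmeas
    ((hΦ.continuousWithinAt.clm_apply (hf.continuousWithinAt_toNNReal t)).mono Ioi_subset_Ici_self)

lemma continuous_exp_smul (A : E →L[ℝ] E) : Continuous fun s : ℝ => NormedSpace.exp (s • A) :=
  continuous_iff_continuousAt.2 fun s => (hasDerivAt_exp_smul_const A s).continuousAt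

lemma exp_smul_mul_exp_neg_smul (A : E →L[ℝ] E) (s : ℝ) :
    NormedSpace.exp (s • A) * NormedSpace.exp (-s • A) = 1 := by
  rw [← NormedSpace.exp_add_of_commute_of_mem_ball (𝕂 := ℝ)]
  · simp
  · exact ((Commute.refl A).smul_left _).smul_right _
  · simp [NormedSpace.expSeries_radius_eq_top]
  · simp [NormedSpace.expSeries_radius_eq_top]

lemma continuous_exp_neg_smul_mul (A : E →L[ℝ] E) :
    Continuous fun s : ℝ => NormedSpace.exp (-s • A) * A :=
  ((continuous_exp_smul A).comp continuous_neg).mul continuous_const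

lemma isCadlag_mildPath (hg : IsCadlag g) : IsCadlag (mildPath A x g) := by
  have hint := hg.continuous_integral_clm_apply (continuous_exp_neg_smul_mul A)
  exact IsCadlag.add (.of_continuous (((continuous_exp_smul A).comp NNReal.continuous_coe).clm_apply
    (continuous_const.add (hint.comp NNReal.continuous_coe)))) hg

theorem mildPath_eq_add_integral (hg : IsCadlag g) (t : ℝ≥0) :
    mildPath A x g t = x + (∫ s in (0 : ℝ)..t, A (mildPath A x g s.toNNReal)) + g t := by
  let K : ℝ → E := fun s => NormedSpace.exp (s • A)
    (x + ∫ r in (0 : ℝ)..s, (NormedSpace.exp (-r • A) * A) (g r.toNNReal))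
  have mildPath_eq (s : ℝ) (hs : 0 ≤ s) : mildPath A x g s.toNNReal = K s + g s.toNNReal := by
    simp [mildPath, K, hs]
  have hK : Continuous K := (continuous_exp_smul A).clm_apply
    (continuous_const.add (hg.continuous_integral_clm_apply (continuous_exp_neg_smul_mul A)))
  have hderiv (s : ℝ) (hs : s ∈ Ioo (min 0 (t : ℝ)) (max 0 (t : ℝ))) :
      HasDerivWithinAt K (A (mildPath A x g s.toNNReal)) (Ioi s) s := by
    have hs0 : 0 ≤ s := (le_min le_rfl t.coe_nonneg).trans hs.1.le
    have hint :=
      (hg.hasDerivWithinAt_integral_clm_apply (continuous_exp_neg_smul_mul A) s).const_add x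
    refine (((hasDerivAt_exp_smul_const' A s).hasDerivWithinAt.clm_apply hint).congr_deriv ?_).mono
      Ioi_subset_Ici_self
    have hexp : NormedSpace.exp (s • A) (NormedSpace.exp (-s • A) (A (g s.toNNReal))) =
        A (g s.toNNReal) := DFunLike.congr_fun (exp_smul_mul_exp_neg_smul A s) _
    rw [mildPath_eq s hs0, map_add]
    simpa [K] using hexp
  have hint := (isCadlag_mildPath (A := A) (x := x) hg).intervalIntegrable_clm_apply
    (Φ := fun _ => A) continuous_const 0 t
  rw [intervalIntegral.integral_eq_sub_of_hasDeriv_right hK.continuousOn hderiv hint]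
  simpa [K] using mildPath_eq t t.coe_nonneg

/-- Grönwall's inequality, applied to the primitive. -/
theorem IsCadlag.eq_zero_of_forall_eq_integral {d : ℝ≥0 → E} (hd : IsCadlag d)
    (h : ∀ t : ℝ≥0, d t = ∫ s in (0 : ℝ)..t, A (d s.toNNReal)) (t : ℝ≥0) : d t = 0 := by
  let D : ℝ → E := fun s => ∫ r in (0 : ℝ)..s, A (d r.toNNReal)
  have hA : Continuous fun _ : ℝ => A := continuous_const
  have hderiv (s : ℝ) (_ : s ∈ Ico 0 (t : ℝ)) : HasDerivWithinAt D (A (d s.toNNReal)) (Ici s) s :=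
    hd.hasDerivWithinAt_integral_clm_apply hA s
  have hbound (s : ℝ) (hs : s ∈ Ico 0 (t : ℝ)) : ‖A (d s.toNNReal)‖ ≤ ‖A‖ * ‖D s‖ := by
    have hD : d s.toNNReal = D s := by rw [h, Real.coe_toNNReal s hs.1]
    exact hD ▸ A.le_opNorm _
  rw [h t]
  exact eq_zero_of_abs_deriv_le_mul_abs_self_of_eq_zero_right
    (hd.continuous_integral_clm_apply hA).continuousOn hderiv (by simp) hbound t
    ⟨t.coe_nonneg, le_rfl⟩

lemma exp_apply_of_eigenvector {b : E} {μ : ℝ} (hb : A b = μ • b) :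
    NormedSpace.exp A b = Real.exp μ • b := by
  have hpow (k : ℕ) : (A ^ k) b = μ ^ k • b := by
    induction k with
    | zero => simp
    | succ k ih => rw [pow_succ, mul_apply_eq_comp, hb, map_smul, ih, smul_smul, pow_succ, mul_comm]
  have hA := (ContinuousLinearMap.apply ℝ E b).hasSum
    (NormedSpace.exp_series_hasSum_exp' (𝕂 := ℝ) A)
  have hμ := (NormedSpace.exp_series_hasSum_exp' (𝕂 := ℝ) μ).smul_const b
  rw [← Real.exp_eq_exp_ℝ] at hμ
  exact hA.unique (hμ.congr_fun fun k => by simp [hpow, smul_smul])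

lemma exp_smul_apply_of_eigenvector {b : E} {μ : ℝ} (hb : A b = μ • b) (s : ℝ) :
    NormedSpace.exp (s • A) b = Real.exp (s * μ) • b :=
  exp_apply_of_eigenvector (by rw [smul_apply, hb, smul_smul])

lemma mildPath_sum_smul_of_eigenvectors {ι : Type*} [Fintype ι] {b : ι → E} {μ : ι → ℝ}
    (hb : ∀ i, A (b i) = μ i • b i) {c : ι → ℝ≥0 → ℝ} (hc : ∀ i, IsCadlag (c i)) (t : ℝ≥0) :
    mildPath A x (fun s => ∑ i, c i s • b i) t = NormedSpace.exp ((t : ℝ) • A) x +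
      ∑ i, (c i t + ∫ s in (0 : ℝ)..t, μ i * Real.exp (μ i * (t - s)) * c i s.toNNReal) • b i := by
  have hexp (s : ℝ) (i : ι) :
      NormedSpace.exp (-s • A) (A (b i)) = (μ i * Real.exp (-s * μ i)) • b i := by
    rw [hb, map_smul, exp_smul_apply_of_eigenvector (hb i), smul_smul]
  have hconv : ∫ s in (0 : ℝ)..t, NormedSpace.exp (-s • A) (A (∑ i, c i s.toNNReal • b i)) =
      ∑ i, (∫ s in (0 : ℝ)..t, μ i * Real.exp (-s * μ i) * c i s.toNNReal) • b i := by
    simp_rw [map_sum, map_smul, hexp, smul_smul, mul_comm (c _ _)]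
    rw [intervalIntegral.integral_finsetSum fun i _ => ?_]
    · simp_rw [intervalIntegral.integral_smul_const]
    · exact (((hc i).intervalIntegrable 0 t).continuousOn_mul (by fun_prop)).smul_continuousOn
        continuousOn_const
  have hfactor (i : ι) (s : ℝ) : μ i * Real.exp (μ i * (t - s)) * c i s.toNNReal =
      Real.exp (t * μ i) * (μ i * Real.exp (-s * μ i) * c i s.toNNReal) := by
    rw [mul_sub, sub_eq_add_neg, Real.exp_add]
    ring_nf
  simp_rw [mildPath, hconv, hfactor, intervalIntegral.integral_const_mul, map_add, map_sum,
    map_smul, exp_smul_apply_of_eigenvector (hb _), smul_smul, add_smul, Finset.sum_add_distrib]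
  simp_rw [mul_comm]
  abel

end MildPath

namespace IsOUSolution

variable {Ω : Type*} [MeasurableSpace Ω] {N : ℕ} {P : Measure Ω}
  {A S : EuclideanSpace ℝ (Fin N) →L[ℝ] EuclideanSpace ℝ (Fin N)}
  {Y X X' : ℝ≥0 → Ω → EuclideanSpace ℝ (Fin N)} {x : EuclideanSpace ℝ (Fin N)}

theorem of_mildPath (hY : ∀ᵐ ω ∂P, IsCadlag fun t => Y t ω) :
    IsOUSolution P A S Y x fun t ω => mildPath A x (fun s => S (Y s ω - Y 0 ω)) t := by
  filter_upwards [hY] with ω hω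
  have hg : IsCadlag fun s => S (Y s ω - Y 0 ω) :=
    hω.continuous_comp (φ := fun y => S (y - Y 0 ω)) (by fun_prop)
  exact ⟨isCadlag_mildPath hg, mildPath_eq_add_integral hg⟩

theorem ae_eq (hX : IsOUSolution P A S Y x X) (hX' : IsOUSolution P A S Y x X') :
    ∀ᵐ ω ∂P, ∀ t, X t ω = X' t ω := by
  filter_upwards [hX, hX'] with ω ⟨hXcad, hXeq⟩ ⟨hXcad', hXeq'⟩ t
  have hd : IsCadlag fun t => X t ω - X' t ω := by
    simpa only [sub_eq_add_neg] using hXcad.add (hXcad'.continuous_comp continuous_neg)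
  refine sub_eq_zero.1 (hd.eq_zero_of_forall_eq_integral (A := A) (fun t => ?_) t)
  have hint {Z : ℝ≥0 → Ω → EuclideanSpace ℝ (Fin N)} (hZ : IsCadlag fun t => Z t ω) :
      IntervalIntegrable (fun s : ℝ => A (Z s.toNNReal ω)) volume 0 t :=
    hZ.intervalIntegrable_clm_apply (Φ := fun _ => A) continuous_const 0 t
  simp_rw [map_sub]
  rw [intervalIntegral.integral_sub (hint hXcad) (hint hXcad'), hXeq, hXeq']
  abel

end IsOUSolution

/-! ### Riemann sums along sequences of partitions -/

/-- A sequence of partitions `0 = u k 0 ≤ ⋯ ≤ u k (m k) = t` of `[0, t]` with mesh tending to `0`.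
The values `u k i` with `i > m k` are irrelevant. -/
structure IsPartitionSeq (t : ℝ≥0) (m : ℕ → ℕ) (u : ℕ → ℕ → ℝ≥0) : Prop where
  mono : ∀ k, Monotone (u k)
  zero : ∀ k, u k 0 = 0
  last : ∀ k, u k (m k) = t
  mesh : ∀ δ : ℝ, 0 < δ → ∀ᶠ k in atTop, ∀ i < m k, (u k (i + 1) : ℝ) - u k i ≤ δ

lemma exists_mem_Ioc_succ {α : Type*} [LinearOrder α] {u : ℕ → α} {m : ℕ} {s : α}
    (hs : s ∈ Ioc (u 0) (u m)) : ∃ i < m, s ∈ Ioc (u i) (u (i + 1)) := by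
  induction m with
  | zero => exact absurd hs.2 (not_le.2 hs.1)
  | succ m ih =>
    by_cases h : s ≤ u m
    · obtain ⟨i, hi, his⟩ := ih ⟨hs.1, h⟩
      exact ⟨i, hi.trans (Nat.lt_succ_self m), his⟩
    · exact ⟨m, Nat.lt_succ_self m, not_le.1 h, hs.2⟩

lemma sum_indicator_Ioc_succ_eq {α M : Type*} [Preorder α] [AddCommMonoid M] {u : ℕ → α}
    (hu : Monotone u) {m i : ℕ} (hi : i < m) {s : α} (hs : s ∈ Ioc (u i) (u (i + 1)))
    (c : ℕ → M) :
    ∑ j ∈ Finset.range m, (Ioc (u j) (u (j + 1))).indicator (fun _ => c j) s = c i := by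
  rw [Finset.sum_eq_single_of_mem i (Finset.mem_range.2 hi), indicator_of_mem hs]
  intro j _ hji
  exact indicator_of_notMem
    (fun hj => disjoint_left.1 (hu.pairwise_disjoint_on_Ioc_succ hji) hj hs) _

lemma measurableEmbedding_coe_nnreal : MeasurableEmbedding ((↑) : ℝ≥0 → ℝ) :=
  MeasurableEmbedding.subtype_coe (s := Ici (0 : ℝ)) measurableSet_Ici

lemma restrict_comap_coe_nnreal_Ioc (a b : ℝ≥0) :
    (((volume : Measure ℝ).comap ((↑) : ℝ≥0 → ℝ)).restrict (Ioc a b)).map (↑) =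
      volume.restrict (Ioc (a : ℝ) b) := by
  have hpre : ((↑) : ℝ≥0 → ℝ) ⁻¹' Ioc (a : ℝ) b = Ioc a b := by ext s; simp
  have hsub : Ioc (a : ℝ) b ⊆ range ((↑) : ℝ≥0 → ℝ) := fun s hs =>
    ⟨⟨s, a.coe_nonneg.trans hs.1.le⟩, rfl⟩
  rw [← hpre, ← measurableEmbedding_coe_nnreal.restrict_map,
    measurableEmbedding_coe_nnreal.map_comap, Measure.restrict_restrict measurableSet_Ioc,
    inter_eq_left.2 hsub]

lemma setIntegral_comap_coe_nnreal (g : ℝ → ℝ) {a b : ℝ≥0} (hab : a ≤ b) :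
    ∫ s in Ioc a b, g s ∂((volume : Measure ℝ).comap ((↑) : ℝ≥0 → ℝ)) =
      ∫ s in (a : ℝ)..b, g s := by
  rw [intervalIntegral.integral_of_le (NNReal.coe_le_coe.2 hab), ← restrict_comap_coe_nnreal_Ioc,
    measurableEmbedding_coe_nnreal.integral_map]

lemma integrableOn_comap_coe_nnreal {g : ℝ → ℝ} (hg : Continuous g) (a b : ℝ≥0) :
    IntegrableOn (fun s : ℝ≥0 => g s) (Ioc a b) ((volume : Measure ℝ).comap ((↑) : ℝ≥0 → ℝ)) := by
  have h : Integrable g (volume.restrict (Ioc (a : ℝ) b)) := hg.integrableOn_Ioc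
  rwa [← restrict_comap_coe_nnreal_Ioc, measurableEmbedding_coe_nnreal.integrable_map_iff] at h

namespace IsPartitionSeq

lemma uniform (t : ℝ≥0) : IsPartitionSeq t (fun k => k + 1) (fun k i => t * (i / (k + 1))) where
  mono k i j hij := by
    dsimp only
    gcongr
  zero k := by simp
  last k := by
    have : ((k + 1 : ℕ) : ℝ≥0) / (k + 1) = 1 := by
      push_cast
      exact div_self (by positivity)
    rw [this, mul_one]
  mesh δ hδ := by
    have h : Tendsto (fun k : ℕ => (t : ℝ) * (1 / ((k : ℝ) + 1))) atTop (𝓝 0) := by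
      simpa using (tendsto_one_div_add_atTop_nhds_zero_nat (𝕜 := ℝ)).const_mul (t : ℝ)
    filter_upwards [h.eventually_le_const hδ] with k hk i _
    refine le_trans (le_of_eq ?_) hk
    push_cast
    ring

variable {t : ℝ≥0} {m : ℕ → ℕ} {u : ℕ → ℕ → ℝ≥0}

lemma le_last (hu : IsPartitionSeq t m u) {k i : ℕ} (hi : i ≤ m k) : u k i ≤ t :=
  hu.last k ▸ hu.mono k hi

lemma exists_mem_Ioc (hu : IsPartitionSeq t m u) {s : ℝ≥0} (hs : s ∈ Ioc 0 t) :
    ∃ i : ℕ → ℕ, ∀ k, i k < m k ∧ s ∈ Ioc (u k (i k)) (u k (i k + 1)) := by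
  have h (k : ℕ) : ∃ i < m k, s ∈ Ioc (u k i) (u k (i + 1)) :=
    exists_mem_Ioc_succ (by rwa [hu.zero, hu.last])
  choose i hi using h
  exact ⟨i, hi⟩

lemma tendsto_of_mem_Icc (hu : IsPartitionSeq t m u) {s : ℝ≥0} {i : ℕ → ℕ}
    (hi : ∀ k, i k < m k ∧ s ∈ Ioc (u k (i k)) (u k (i k + 1))) {p : ℕ → ℝ≥0}
    (hp : ∀ k, p k ∈ Icc (u k (i k)) (u k (i k + 1))) : Tendsto p atTop (𝓝 s) := by
  rw [← NNReal.tendsto_coe, Metric.tendsto_nhds]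
  intro ε hε
  filter_upwards [hu.mesh (ε / 2) (half_pos hε)] with k hk
  have hmesh := hk _ (hi k).1
  have hleft : (u k (i k) : ℝ) < s := (hi k).2.1
  have hright : (s : ℝ) ≤ u k (i k + 1) := (hi k).2.2
  have hpleft : (u k (i k) : ℝ) ≤ p k := (hp k).1
  have hpright : (p k : ℝ) ≤ u k (i k + 1) := (hp k).2
  rw [Real.dist_eq, abs_lt]
  constructor <;> linarith

lemma tendsto_left (hu : IsPartitionSeq t m u) {s : ℝ≥0} {i : ℕ → ℕ}
    (hi : ∀ k, i k < m k ∧ s ∈ Ioc (u k (i k)) (u k (i k + 1))) :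
    Tendsto (fun k => u k (i k)) atTop (𝓝 s) :=
  hu.tendsto_of_mem_Icc hi fun k => left_mem_Icc.2 (hu.mono k (Nat.le_succ _))

lemma tendsto_right (hu : IsPartitionSeq t m u) {s : ℝ≥0} {i : ℕ → ℕ}
    (hi : ∀ k, i k < m k ∧ s ∈ Ioc (u k (i k)) (u k (i k + 1))) :
    Tendsto (fun k => u k (i k + 1)) atTop (𝓝[≥] s) :=
  tendsto_nhdsWithin_iff.2
    ⟨hu.tendsto_of_mem_Icc hi fun k => right_mem_Icc.2 (hu.mono k (Nat.le_succ _)),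
      Eventually.of_forall fun k => (hi k).2.2⟩

lemma sum_mul_setIntegral_eq (hu : IsPartitionSeq t m u) {μ : Measure ℝ≥0} {w : ℝ≥0 → ℝ}
    (hw : IntegrableOn w (Ioc 0 t) μ) (c : ℕ → ℝ) (k : ℕ) :
    ∑ i ∈ Finset.range (m k), c i * ∫ s in Ioc (u k i) (u k (i + 1)), w s ∂μ =
      ∫ s in Ioc 0 t, (∑ i ∈ Finset.range (m k),
        (Ioc (u k i) (u k (i + 1))).indicator (fun _ => c i) s) * w s ∂μ := by
  have hind (i : ℕ) (s : ℝ≥0) : (Ioc (u k i) (u k (i + 1))).indicator (fun _ => c i) s * w s =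
      (Ioc (u k i) (u k (i + 1))).indicator (fun s => c i * w s) s := by
    rw [indicator_mul_left]
  simp_rw [Finset.sum_mul, hind]
  rw [integral_finsetSum _ fun i _ => (hw.const_mul (c i)).indicator measurableSet_Ioc]
  refine Finset.sum_congr rfl fun i hi => ?_
  have hsub : Ioc (u k i) (u k (i + 1)) ⊆ Ioc 0 t :=
    Ioc_subset_Ioc zero_le (hu.le_last (Finset.mem_range.1 hi))
  rw [setIntegral_indicator measurableSet_Ioc, inter_eq_right.2 hsub, integral_const_mul]

/-- The values `c k i` approximate `y` on the `i`-th interval of the `k`-th partition. Leaving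
them free covers both left endpoints, for continuous `y`, and right endpoints, for càdlàg `y`. -/
theorem tendsto_sum_mul_setIntegral (hu : IsPartitionSeq t m u) {μ : Measure ℝ≥0} {w : ℝ≥0 → ℝ}
    (hw : IntegrableOn w (Ioc 0 t) μ) {c : ℕ → ℕ → ℝ} {y : ℝ≥0 → ℝ} {C : ℝ}
    (hC : ∀ k, ∀ i < m k, |c k i| ≤ C)
    (hc : ∀ s ∈ Ioc 0 t, ∀ i : ℕ → ℕ, (∀ k, i k < m k ∧ s ∈ Ioc (u k (i k)) (u k (i k + 1))) →
      Tendsto (fun k => c k (i k)) atTop (𝓝 (y s))) :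
    Tendsto (fun k => ∑ i ∈ Finset.range (m k),
        c k i * ∫ s in Ioc (u k i) (u k (i + 1)), w s ∂μ) atTop
      (𝓝 (∫ s in Ioc 0 t, y s * w s ∂μ)) := by
  simp_rw [fun k => hu.sum_mul_setIntegral_eq hw (c k) k]
  refine tendsto_integral_of_dominated_convergence (fun s => C * ‖w s‖) (fun k => ?_)
    (hw.norm.const_mul C) (fun k => ?_) ?_
  · refine AEStronglyMeasurable.mul (Measurable.aestronglyMeasurable ?_) hw.aestronglyMeasurable
    exact Finset.measurable_sum _ fun i _ => measurable_const.indicator measurableSet_Ioc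
  · filter_upwards [ae_restrict_mem measurableSet_Ioc] with s hs
    obtain ⟨i, hi⟩ := hu.exists_mem_Ioc hs
    rw [sum_indicator_Ioc_succ_eq (hu.mono k) (hi k).1 (hi k).2, norm_mul]
    exact mul_le_mul_of_nonneg_right (hC k _ (hi k).1) (norm_nonneg _)
  · filter_upwards [ae_restrict_mem measurableSet_Ioc] with s hs
    obtain ⟨i, hi⟩ := hu.exists_mem_Ioc hs
    simp_rw [fun k => sum_indicator_Ioc_succ_eq (hu.mono k) (hi k).1 (hi k).2 (c k)]
    exact (hc _ hs i hi).mul_const _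

lemma tendsto_sum_mul_timeChange (hu : IsPartitionSeq t m u) (ℓ : TimeChange) {y : ℝ≥0 → ℝ}
    (hy : Continuous y) :
    Tendsto (fun k => ∑ i ∈ Finset.range (m k),
      y (u k i) * ((ℓ (u k (i + 1)) : ℝ) - ℓ (u k i))) atTop (𝓝 (ℓ.integral y t)) := by
  obtain ⟨C, hC⟩ := (IsCadlag.of_continuous hy).exists_norm_le t
  have hw : IntegrableOn (fun _ => (1 : ℝ)) (Ioc 0 t) ℓ.stieltjes.measure :=
    integrableOn_const (by rw [StieltjesFunction.measure_Ioc]; exact ENNReal.ofReal_ne_top)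
  have hlim := hu.tendsto_sum_mul_setIntegral hw (c := fun k i => y (u k i)) (y := y)
    (fun k i hi => hC _ (hu.le_last hi.le))
    (fun s _ i hi => (hy.tendsto s).comp (hu.tendsto_left hi))
  simp only [mul_one] at hlim
  refine hlim.congr fun k => Finset.sum_congr rfl fun i _ => ?_
  rw [setIntegral_const, smul_eq_mul, mul_one, Measure.real, StieltjesFunction.measure_Ioc,
    ENNReal.toReal_ofReal (sub_nonneg.2 (ℓ.stieltjes.mono (hu.mono k (Nat.le_succ i))))]
  rfl

end IsPartitionSeq

/-! ### Integrals of smooth functions against càdlàg paths -/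

/-- The integral `∫ s in (0, t], f s dy s` of a `C¹` function `f` against a càdlàg path `y`, which
need not have bounded variation, defined through integration by parts. -/
noncomputable def pathIntegral (f : ℝ → ℝ) (y : ℝ≥0 → ℝ) (t : ℝ≥0) : ℝ :=
  f t * (y t - y 0) - ∫ s in (0 : ℝ)..t, deriv f s * (y s.toNNReal - y 0)

/-- Summation by parts, after which `f` is integrated against the derivative of the integrand. -/
theorem IsPartitionSeq.tendsto_sum_mul_sub {t : ℝ≥0} {m : ℕ → ℕ} {u : ℕ → ℕ → ℝ≥0}
    (hu : IsPartitionSeq t m u) {f : ℝ → ℝ} (hf : ContDiff ℝ 1 f) {y : ℝ≥0 → ℝ}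
    (hy : IsCadlag y) :
    Tendsto (fun k => ∑ i ∈ Finset.range (m k), f (u k i) * (y (u k (i + 1)) - y (u k i))) atTop
      (𝓝 (pathIntegral f y t)) := by
  let g : ℝ≥0 → ℝ := fun s => y s - y 0
  let ν : Measure ℝ≥0 := (volume : Measure ℝ).comap (↑)
  have hg : IsCadlag g := hy.continuous_comp (continuous_id.sub continuous_const)
  have hf' : Continuous (deriv f) := hf.continuous_deriv_one
  have integral_deriv (a b : ℝ≥0) (hab : a ≤ b) :
      ∫ s in Ioc a b, deriv f s ∂ν = f b - f a := by
    rw [setIntegral_comap_coe_nnreal _ hab]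
    exact intervalIntegral.integral_deriv_eq_sub
      (fun s _ => (hf.differentiable one_ne_zero) s) (hf'.intervalIntegrable _ _)
  obtain ⟨C, hC⟩ := hg.exists_norm_le t
  have hlim := hu.tendsto_sum_mul_setIntegral (integrableOn_comap_coe_nnreal hf' 0 t)
    (c := fun k i => g (u k (i + 1))) (fun k i hi => hC _ (hu.le_last hi))
    (fun s _ i hi => (hg s).1.tendsto.comp (hu.tendsto_right hi))
  have hintegral : ∫ s in Ioc 0 t, g s * deriv f s ∂ν =
      ∫ s in (0 : ℝ)..t, deriv f s * (y s.toNNReal - y 0) := by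
    simpa [g, mul_comm] using
      setIntegral_comap_coe_nnreal (fun s => g s.toNNReal * deriv f s) (zero_le : 0 ≤ t)
  rw [hintegral] at hlim
  refine (hlim.const_sub (f t * g t)).congr fun k => ?_
  have telescope := Finset.sum_range_sub (fun i => f (u k i) * g (u k i)) (m k)
  simp only [hu.zero, hu.last, show g 0 = 0 from sub_self _, mul_zero, sub_zero] at telescope
  rw [← telescope, ← Finset.sum_sub_distrib]
  refine Finset.sum_congr rfl fun i _ => ?_
  rw [integral_deriv _ _ (hu.mono k (Nat.le_succ i))]
  ring

/-! ### Stochastic integrals -/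

section StochIntegral

variable {Ω : Type*} [MeasurableSpace Ω] {P : Measure Ω}

namespace IsStochIntegral

variable {f : ℝ≥0 → ℝ} {Y : ℝ≥0 → Ω → ℝ} {t : ℝ≥0} {I : Ω → ℝ}

lemma tendstoInMeasure (hI : IsStochIntegral P f Y t I) {m : ℕ → ℕ} {u : ℕ → ℕ → ℝ≥0}
    (hu : IsPartitionSeq t m u) :
    TendstoInMeasure P (fun k ω => ∑ i ∈ Finset.range (m k),
      f (u k i) * (Y (u k (i + 1)) ω - Y (u k i) ω)) atTop I := by
  rw [tendstoInMeasure_iff_dist]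
  intro ε hε
  rw [ENNReal.tendsto_nhds_zero]
  intro η hη
  by_cases hη_top : η = ∞
  · simp [hη_top]
  have hη_pos : 0 < η.toReal := ENNReal.toReal_pos hη.ne' hη_top
  obtain ⟨δ, hδ, h⟩ := hI.2 (min ε η.toReal) (lt_min hε hη_pos)
  filter_upwards [hu.mesh δ hδ] with k hk
  calc P {ω | ε ≤ dist (∑ i ∈ Finset.range (m k),
          f (u k i) * (Y (u k (i + 1)) ω - Y (u k i) ω)) (I ω)}
      ≤ P {ω | min ε η.toReal ≤ |∑ i ∈ Finset.range (m k),
          f (u k i) * (Y (u k (i + 1)) ω - Y (u k i) ω) - I ω|} :=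
        measure_mono fun ω hω => (min_le_left _ _).trans (mem_ofPred_eq ▸ hω)
    _ ≤ ENNReal.ofReal (min ε η.toReal) := h _ _ (hu.mono k) (hu.zero k) (hu.last k) hk
    _ ≤ ENNReal.ofReal η.toReal := ENNReal.ofReal_le_ofReal (min_le_right _ _)
    _ = η := ENNReal.ofReal_toReal hη_top

lemma ae_eq {I' : Ω → ℝ} (hI : IsStochIntegral P f Y t I) (hI' : IsStochIntegral P f Y t I') :
    I =ᵐ[P] I' :=
  tendstoInMeasure_ae_unique (hI.tendstoInMeasure (.uniform t))
    (hI'.tendstoInMeasure (.uniform t))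

lemma isStochIntegral_stochIntegral (hI : IsStochIntegral P f Y t I) :
    IsStochIntegral P f Y t (stochIntegral P f Y t) := by
  have h : ∃ I, IsStochIntegral P f Y t I := ⟨I, hI⟩
  rw [stochIntegral, dif_pos h]
  exact h.choose_spec

lemma of_forall_tendsto [IsFiniteMeasure P] (hY : ∀ s, AEMeasurable (Y s) P)
    (h : ∀ m u, IsPartitionSeq t m u → ∀ᵐ ω ∂P, Tendsto (fun k => ∑ i ∈ Finset.range (m k),
      f (u k i) * (Y (u k (i + 1)) ω - Y (u k i) ω)) atTop (𝓝 (I ω))) :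
    IsStochIntegral P f Y t I := by
  have hmeas (m : ℕ) (u : ℕ → ℝ≥0) : AEMeasurable (fun ω => ∑ i ∈ Finset.range m,
      f (u i) * (Y (u (i + 1)) ω - Y (u i) ω)) P :=
    Finset.aemeasurable_fun_sum _ fun i _ => ((hY _).sub (hY _)).const_mul _
  refine ⟨aemeasurable_of_tendsto_metrizable_ae atTop (fun k => hmeas _ _)
    (h _ _ (.uniform t)), fun ε hε => ?_⟩
  by_contra! hcon
  have hδ (k : ℕ) : (0 : ℝ) < 1 / ((k : ℝ) + 1) := by positivity
  choose m u hmono hzero hlast hmesh hlt using fun k : ℕ => hcon _ (hδ k)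
  have hu : IsPartitionSeq t m u := ⟨hmono, hzero, hlast, fun δ hδ' => by
    filter_upwards [(tendsto_one_div_add_atTop_nhds_zero_nat (𝕜 := ℝ)).eventually_le_const hδ']
      with k hk i hi using (hmesh k i hi).trans hk⟩
  have hlim := tendstoInMeasure_of_tendsto_ae
    (fun k => (hmeas (m k) (u k)).aestronglyMeasurable) (h m u hu)
  rw [tendstoInMeasure_iff_dist] at hlim
  obtain ⟨k, hk⟩ := ((hlim ε hε).eventually_lt_const (ENNReal.ofReal_pos.2 hε)).exists
  exact lt_asymm hk (hlt k)

lemma of_isCadlag [IsFiniteMeasure P] (hY : ∀ s, AEMeasurable (Y s) P)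
    (hcad : ∀ᵐ ω ∂P, IsCadlag fun s => Y s ω) {f : ℝ → ℝ} (hf : ContDiff ℝ 1 f) (t : ℝ≥0) :
    IsStochIntegral P (fun s => f s) Y t fun ω => pathIntegral f (fun s => Y s ω) t :=
  of_forall_tendsto hY fun _ _ hu => by
    filter_upwards [hcad] with ω hω using hu.tendsto_sum_mul_sub hf hω

lemma exists_measurable_ae_eq (hI : IsStochIntegral P f Y t I) :
    ∃ F : (ℝ≥0 → ℝ) → ℝ, Measurable F ∧ (fun ω => F fun s => Y s ω) =ᵐ[P] I := by
  let S (k : ℕ) (y : ℝ≥0 → ℝ) : ℝ := ∑ i ∈ Finset.range (k + 1), f (t * (i / (k + 1))) *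
    (y (t * ((i + 1 : ℕ) / (k + 1))) - y (t * (i / (k + 1))))
  have hS (k : ℕ) : Measurable (S k) := Finset.measurable_sum _ fun i _ => by fun_prop
  obtain ⟨ns, -, hns⟩ := (hI.tendstoInMeasure (.uniform t)).exists_seq_tendsto_ae
  refine ⟨fun y => limUnder atTop fun k => S (ns k) y,
    (StronglyMeasurable.limUnder fun k => (hS (ns k)).stronglyMeasurable).measurable, ?_⟩
  filter_upwards [hns] with ω hω using hω.limUnder_eq

end IsStochIntegral

lemma iIndepFun_of_isStochIntegral {ι : Type*} {Y : ι → ℝ≥0 → Ω → ℝ}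
    (hY : iIndepFun (fun n ω t => Y n t ω) P) {f : ι → ℝ≥0 → ℝ} {t : ι → ℝ≥0} {I : ι → Ω → ℝ}
    (hI : ∀ n, IsStochIntegral P (f n) (Y n) (t n) (I n)) : iIndepFun I P := by
  choose F hF hFI using fun n => (hI n).exists_measurable_ae_eq
  exact (hY.comp F hF).congr hFI

end StochIntegral

/-! ### Integrals against a time-changed Brownian motion -/

namespace TimeChange

variable (ℓ : TimeChange)

lemma measure_Ioc_zero (t : ℝ≥0) : ℓ.stieltjes.measure (Ioc 0 t) = ENNReal.ofReal (ℓ t) := by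
  rw [StieltjesFunction.measure_Ioc]
  change ENNReal.ofReal ((ℓ t : ℝ) - ℓ 0) = ENNReal.ofReal (ℓ t)
  rw [ℓ.map_zero', NNReal.coe_zero, sub_zero]

lemma integrableOn_of_continuous {g : ℝ≥0 → ℝ} (hg : Continuous g) (t : ℝ≥0) :
    IntegrableOn g (Ioc 0 t) ℓ.stieltjes.measure := by
  obtain ⟨C, hC⟩ := (IsCadlag.of_continuous hg).exists_norm_le t
  refine Measure.integrableOn_of_bounded (M := C) ?_ hg.aestronglyMeasurable ?_
  · rw [measure_Ioc_zero]
    exact ENNReal.ofReal_ne_top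
  · exact (ae_restrict_iff' measurableSet_Ioc).2 (Eventually.of_forall fun s hs => hC s hs.2)

lemma integral_nonneg {g : ℝ≥0 → ℝ} (hg : ∀ s, 0 ≤ g s) (t : ℝ≥0) : 0 ≤ ℓ.integral g t :=
  MeasureTheory.integral_nonneg hg

lemma integral_pos {g : ℝ≥0 → ℝ} (hg : Continuous g) (hpos : ∀ s, 0 < g s) {t : ℝ≥0}
    (ht : 0 < t) : 0 < ℓ.integral g t := by
  rw [TimeChange.integral, setIntegral_pos_iff_support_of_nonneg_ae
    (Eventually.of_forall fun s => (hpos s).le) (ℓ.integrableOn_of_continuous hg t),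
    Function.support_eq_univ fun s => (hpos s).ne', univ_inter, measure_Ioc_zero]
  exact ENNReal.ofReal_pos.2 (ℓ.pos' t ht)

end TimeChange

section TimeChangedBrownianMotion

variable {Ω : Type*} [MeasurableSpace Ω] {P : Measure Ω}

lemma hasLaw_gaussianReal_of_tendstoInMeasure [IsProbabilityMeasure P] {X : ℕ → Ω → ℝ} {Z : Ω → ℝ}
    {μ : ℕ → ℝ} {v : ℕ → ℝ≥0} {a : ℝ} {w : ℝ≥0}
    (hX : ∀ k, HasLaw (X k) (gaussianReal (μ k) (v k)) P) (hμ : Tendsto μ atTop (𝓝 a))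
    (hv : Tendsto v atTop (𝓝 w)) (hZ : TendstoInMeasure P X atTop Z) :
    HasLaw Z (gaussianReal a w) P := by
  have hlim := hZ.tendstoInDistribution fun k => (hX k).aemeasurable
  refine ⟨hlim.aemeasurable_limit, ?_⟩
  have := Measure.isProbabilityMeasure_map hlim.aemeasurable_limit (μ := P)
  refine Measure.ext_of_charFun (funext fun θ => ?_)
  have hchar := ProbabilityMeasure.tendsto_iff_tendsto_charFun.1 hlim.tendsto θ
  simp only [ProbabilityMeasure.coe_mk, (hX _).map_eq] at hchar
  have hgauss : Tendsto (fun k => charFun (gaussianReal (μ k) (v k)) θ) atTop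
      (𝓝 (charFun (gaussianReal a w) θ)) := by
    have hcont : Continuous fun p : ℝ × ℝ≥0 => charFun (gaussianReal p.1 p.2) θ := by
      simp only [charFun_gaussianReal]
      fun_prop
    exact (hcont.tendsto (a, w)).comp (hμ.prodMk_nhds hv)
  exact tendsto_nhds_unique hchar hgauss

lemma hasLaw_sum_gaussianReal_of_iIndepFun {ι : Type*} {X : ι → Ω → ℝ} (hind : iIndepFun X P)
    {μ : ι → ℝ} {v : ι → ℝ≥0} (hX : ∀ i, HasLaw (X i) (gaussianReal (μ i) (v i)) P)
    (s : Finset ι) :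
    HasLaw (fun ω => ∑ i ∈ s, X i ω) (gaussianReal (∑ i ∈ s, μ i) (∑ i ∈ s, v i)) P := by
  have := hind.isProbabilityMeasure
  classical
  induction s using Finset.induction_on with
  | empty =>
    simp only [Finset.sum_empty, gaussianReal_zero_var]
    exact ⟨by fun_prop, by simp⟩
  | insert i s hi ih =>
    have hindep : IndepFun (X i) (fun ω => ∑ j ∈ s, X j ω) P := by
      convert (hind.indepFun_finsetSum_of_notMem₀ (fun j => (hX j).aemeasurable) hi).symm using 1
      ext ω
      simp
    simp only [Finset.sum_insert hi]
    exact ⟨(hX i).aemeasurable.add ih.aemeasurable,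
      gaussianReal_add_gaussianReal_of_indepFun hindep (hX i).map_eq ih.map_eq⟩

lemma hasLaw_sum_mul_sub_of_isPreBrownianReal {B : ℝ≥0 → Ω → ℝ} (hB : IsPreBrownianReal B P)
    {τ : ℕ → ℝ≥0} (hτ : Monotone τ) (c : ℕ → ℝ) (m : ℕ) :
    HasLaw (fun ω => ∑ i ∈ Finset.range m, c i * (B (τ (i + 1)) ω - B (τ i) ω))
      (gaussianReal 0 (∑ i ∈ Finset.range m, c i ^ 2 * ((τ (i + 1) : ℝ) - τ i)).toNNReal) P := by
  have hsub (i : ℕ) : 0 ≤ (τ (i + 1) : ℝ) - τ i :=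
    sub_nonneg.2 (NNReal.coe_le_coe.2 (hτ (Nat.le_succ i)))
  have hterm (i : ℕ) : HasLaw (fun ω => c i * (B (τ (i + 1)) ω - B (τ i) ω))
      (gaussianReal 0 (c i ^ 2 * ((τ (i + 1) : ℝ) - τ i)).toNNReal) P := by
    have hvar : (c i ^ 2 * ((τ (i + 1) : ℝ) - τ i)).toNNReal =
        .mk (c i ^ 2) (sq_nonneg _) * nndist (τ (i + 1)).1 (τ i).1 := by
      rw [Real.toNNReal_mul (sq_nonneg _), Real.toNNReal_of_nonneg (sq_nonneg _),
        Real.toNNReal_of_nonneg (hsub i)]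
      exact congrArg _ (NNReal.coe_injective (abs_of_nonneg (hsub i)).symm)
    simpa only [hvar, mul_zero, Pi.sub_apply] using
      gaussianReal_const_mul (hB.hasLaw_sub (τ (i + 1)) (τ i)) (c i)
  have hind : iIndepFun (fun i ω => c i * (B (τ (i + 1)) ω - B (τ i) ω)) P :=
    (hB.hasIndepIncrements.nat hτ).comp (fun i x => c i * x) fun i => by fun_prop
  rw [Real.toNNReal_sum_of_nonneg fun i _ => mul_nonneg (sq_nonneg _) (hsub i)]
  simpa only [Finset.sum_const_zero] using
    hasLaw_sum_gaussianReal_of_iIndepFun hind hterm (Finset.range m)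

namespace IsStochIntegral

theorem hasLaw_gaussianReal {B : ℝ≥0 → Ω → ℝ} (hB : IsPreBrownianReal B P) {ℓ : TimeChange}
    {f : ℝ≥0 → ℝ} (hf : Continuous f) {t : ℝ≥0} {I : Ω → ℝ}
    (hI : IsStochIntegral P f (fun s => B (ℓ s)) t I) :
    HasLaw I (gaussianReal 0 (ℓ.integral (fun s => f s ^ 2) t).toNNReal) P := by
  have := hB.isGaussianProcess.isProbabilityMeasure
  have hu := IsPartitionSeq.uniform t
  exact hasLaw_gaussianReal_of_tendstoInMeasure
    (fun k => hasLaw_sum_mul_sub_of_isPreBrownianReal hB (ℓ.monotone'.comp (hu.mono k)) _ _)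
    tendsto_const_nhds ((continuous_real_toNNReal.tendsto _).comp
      (hu.tendsto_sum_mul_timeChange ℓ (hf.pow 2))) (hI.tendstoInMeasure hu)

theorem hasLaw_pi_gaussianReal {ι : Type*} [Fintype ι] {B : ι → ℝ≥0 → Ω → ℝ}
    (hB : ∀ n, IsPreBrownianReal (B n) P) (hB_indep : iIndepFun (fun n ω s => B n s ω) P)
    {ℓ : TimeChange} {f : ι → ℝ≥0 → ℝ} (hf : ∀ n, Continuous (f n)) {t : ℝ≥0} {I : ι → Ω → ℝ}
    (hI : ∀ n, IsStochIntegral P (f n) (fun s => B n (ℓ s)) t (I n)) :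
    HasLaw (fun ω n => I n ω)
      (Measure.pi fun n => gaussianReal 0 (ℓ.integral (fun s => f n s ^ 2) t).toNNReal) P := by
  have := hB_indep.isProbabilityMeasure
  have hlaw n := (hI n).hasLaw_gaussianReal (hB n) (hf n)
  have hindep : iIndepFun I P := iIndepFun_of_isStochIntegral
    (hB_indep.comp (fun _ b s => b (ℓ s)) fun _ => by fun_prop) hI
  refine ⟨aemeasurable_pi_lambda _ fun n => (hlaw n).aemeasurable, ?_⟩
  rw [(iIndepFun_iff_map_fun_eq_pi_map fun n => (hlaw n).aemeasurable).1 hindep]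
  simp_rw [fun n => (hlaw n).map_eq]

end IsStochIntegral

end TimeChangedBrownianMotion

/-! ### Gaussian vectors -/

section GaussianVector

variable {ι κ : Type*} [Fintype ι]

lemma posSemidef_sum_smul_vecMulVec [Finite κ] (v : ι → ℝ≥0) (b : ι → EuclideanSpace ℝ κ) :
    (∑ i, (v i : ℝ) • Matrix.vecMulVec (b i).ofLp (b i).ofLp).PosSemidef :=
  Matrix.posSemidef_sum _ fun i _ =>
    (Matrix.posSemidef_vecMulVec_self_star (b i).ofLp).smul (v i).coe_nonneg

variable [Fintype κ]

lemma dotProduct_sum_smul_vecMulVec_mulVec (v : ι → ℝ) (b : ι → EuclideanSpace ℝ κ)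
    (x : EuclideanSpace ℝ κ) :
    x.ofLp ⬝ᵥ (∑ i, v i • Matrix.vecMulVec (b i).ofLp (b i).ofLp).mulVec x.ofLp =
      ∑ i, v i * inner ℝ (b i) x ^ 2 := by
  simp_rw [Matrix.sum_mulVec, dotProduct_sum, Matrix.smul_mulVec, dotProduct_smul,
    Matrix.vecMulVec_mulVec, op_smul_eq_smul, dotProduct_smul, smul_eq_mul]
  refine Finset.sum_congr rfl fun i _ => ?_
  rw [EuclideanSpace.inner_eq_star_dotProduct, star_trivial, dotProduct_comm (b i).ofLp, sq]

theorem map_pi_gaussianReal_add_sum_smul [DecidableEq κ] (v : ι → ℝ≥0)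
    (b : ι → EuclideanSpace ℝ κ) (m : EuclideanSpace ℝ κ) :
    (Measure.pi fun i => gaussianReal 0 (v i)).map (fun y => m + ∑ i, y i • b i) =
      multivariateGaussian m (∑ i, (v i : ℝ) • Matrix.vecMulVec (b i).ofLp (b i).ofLp) := by
  have hmeas : Measurable fun y : ι → ℝ => m + ∑ i, y i • b i := by fun_prop
  have := Measure.isProbabilityMeasure_map (μ := Measure.pi fun i => gaussianReal 0 (v i))
    hmeas.aemeasurable
  refine Measure.ext_of_charFun (funext fun x => ?_)
  have hexp (y : ι → ℝ) : Complex.exp (inner ℝ (m + ∑ i, y i • b i) x * Complex.I) =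
      Complex.exp (inner ℝ x m * Complex.I) *
        ∏ i, Complex.exp ((inner ℝ (b i) x : ℝ) * y i * Complex.I) := by
    rw [← Complex.exp_sum, ← Complex.exp_add, ← Finset.sum_mul, ← add_mul, inner_add_left,
      sum_inner, real_inner_comm x m]
    simp_rw [real_inner_smul_left, mul_comm (inner ℝ (b _) x : ℂ)]
    push_cast
    rfl
  rw [charFun_multivariateGaussian (posSemidef_sum_smul_vecMulVec v b),
    dotProduct_sum_smul_vecMulVec_mulVec, charFun_apply, integral_map hmeas.aemeasurable
    (by fun_prop)]
  simp_rw [hexp]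
  rw [integral_const_mul, integral_fintype_prod_eq_prod
    (f := fun i (y : ℝ) => Complex.exp ((inner ℝ (b i) x : ℝ) * y * Complex.I))]
  simp_rw [← charFun_apply_real, charFun_gaussianReal]
  rw [← Complex.exp_sum, ← Complex.exp_add]
  congr 1
  push_cast
  simp [sub_eq_add_neg, Finset.sum_div]

end GaussianVector

/-! ### Translations of Gaussian product measures -/

section CameronMartin

lemma gaussianReal_eq_withDensity_gaussianReal_zero (a : ℝ) {v : ℝ≥0} (hv : v ≠ 0) :
    gaussianReal a v = (gaussianReal 0 v).withDensity
      fun y => ENNReal.ofReal (Real.exp (y / v * a - a ^ 2 / (2 * v))) := by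
  have hv' : (v : ℝ) ≠ 0 := NNReal.coe_ne_zero.2 hv
  rw [gaussianReal_of_var_ne_zero _ hv, gaussianReal_of_var_ne_zero _ hv,
    ← withDensity_mul _ (measurable_gaussianPDF 0 v) (by fun_prop)]
  congr 1
  ext y
  rw [Pi.mul_apply, gaussianPDF, gaussianPDF, ← ENNReal.ofReal_mul (gaussianPDFReal_nonneg _ _ _),
    gaussianPDFReal, gaussianPDFReal, mul_assoc (√(2 * Real.pi * v))⁻¹, ← Real.exp_add]
  congr 3
  field_simp
  ring

lemma measure_pi_withDensity {ι : Type*} [Fintype ι] {X : ι → Type*}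
    [∀ i, MeasurableSpace (X i)] (μ : ∀ i, Measure (X i)) [∀ i, IsProbabilityMeasure (μ i)]
    {f : ∀ i, X i → ℝ≥0∞} (hf : ∀ i, Measurable (f i))
    [∀ i, SigmaFinite ((μ i).withDensity (f i))] :
    Measure.pi (fun i => (μ i).withDensity (f i)) =
      (Measure.pi μ).withDensity fun x => ∏ i, f i (x i) := by
  refine Measure.pi_eq fun s hs => ?_
  have hmeas (i : ι) : Measurable ((s i).indicator (f i)) := (hf i).indicator (hs i)
  have hprod (x : ∀ i, X i) : (univ.pi s).indicator (fun x => ∏ i, f i (x i)) x =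
      ∏ i, (s i).indicator (f i) (x i) := by
    by_cases hx : x ∈ univ.pi s
    · rw [indicator_of_mem hx]
      exact Finset.prod_congr rfl fun i _ => (indicator_of_mem (hx i (mem_univ i)) _).symm
    · rw [indicator_of_notMem hx]
      simp only [Set.mem_pi, mem_univ, true_imp_iff, not_forall] at hx
      obtain ⟨i, hi⟩ := hx
      exact (Finset.prod_eq_zero (Finset.mem_univ i) (indicator_of_notMem hi _)).symm
  rw [withDensity_apply _ (MeasurableSet.univ_pi hs),
    ← lintegral_indicator (MeasurableSet.univ_pi hs)]
  simp_rw [hprod]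
  rw [lintegral_prod_eq_prod_lintegral_of_indepFun Finset.univ _
    (iIndepFun_pi fun i => (hmeas i).aemeasurable)
    fun i => (hmeas i).comp (measurable_pi_apply i)]
  refine Finset.prod_congr rfl fun i _ => ?_
  rw [withDensity_apply _ (hs i), ← lintegral_indicator (hs i)]
  exact (measurePreserving_eval μ i).lintegral_comp (hmeas i)

variable {ι : Type*} [Fintype ι] {v : ι → ℝ≥0}

/-- The score at `y` of the location family `a ↦ N(a, diag v)`: the derivative at `a = 0` of the
logarithm of its density at `y`. -/
noncomputable def gaussianScore (v : ι → ℝ≥0) (y : ι → ℝ) : (ι → ℝ) →L[ℝ] ℝ :=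
  ∑ i, (y i / v i) • ContinuousLinearMap.proj i

lemma gaussianScore_apply (v : ι → ℝ≥0) (y a : ι → ℝ) :
    gaussianScore v y a = ∑ i, y i / v i * a i := by
  simp [gaussianScore]

@[fun_prop]
lemma continuous_gaussianScore (v : ι → ℝ≥0) : Continuous (gaussianScore v) := by
  unfold gaussianScore
  fun_prop

lemma norm_gaussianScore_le (v : ι → ℝ≥0) (y : ι → ℝ) :
    ‖gaussianScore v y‖ ≤ ∑ i, |y i| / v i := by
  refine ContinuousLinearMap.opNorm_le_bound _ (by positivity) fun a => ?_
  rw [gaussianScore_apply, Finset.sum_mul]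
  refine norm_sum_le_of_le _ fun i _ => ?_
  rw [norm_mul, norm_div, Real.norm_eq_abs, NNReal.norm_eq]
  exact mul_le_mul_of_nonneg_left (norm_le_pi_norm a i) (by positivity)

lemma integrable_exp_norm_gaussianScore (v : ι → ℝ≥0) (c : ℝ) :
    Integrable (fun y => Real.exp (c * ‖gaussianScore v y‖))
      (Measure.pi fun i => gaussianReal 0 (v i)) := by
  have hprod : Integrable (fun y : ι → ℝ => ∏ i, Real.exp (|c| / v i * |y i|))
      (Measure.pi fun i => gaussianReal 0 (v i)) :=
    Integrable.fintype_prod (f := fun i y => Real.exp (|c| / v i * |y|)) fun i =>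
      integrable_exp_mul_abs (X := id) (integrable_exp_mul_gaussianReal _)
        (integrable_exp_mul_gaussianReal _)
  refine hprod.mono' (by fun_prop) (Eventually.of_forall fun y => ?_)
  rw [Real.norm_eq_abs, Real.abs_exp, ← Real.exp_sum]
  refine Real.exp_le_exp.2 ?_
  calc c * ‖gaussianScore v y‖ ≤ |c| * ∑ i, |y i| / v i :=
        mul_le_mul (le_abs_self c) (norm_gaussianScore_le v y) (norm_nonneg _) (abs_nonneg c)
    _ = ∑ i, |c| / v i * |y i| := by
        rw [Finset.mul_sum]
        exact Finset.sum_congr rfl fun i _ => by ring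

lemma map_add_pi_gaussianReal (hv : ∀ i, v i ≠ 0) (a : ι → ℝ) :
    (Measure.pi fun i => gaussianReal 0 (v i)).map (a + ·) =
      (Measure.pi fun i => gaussianReal 0 (v i)).withDensity fun y =>
        ENNReal.ofReal (Real.exp (gaussianScore v y a - ∑ i, a i ^ 2 / (2 * v i))) := by
  have hmap : (Measure.pi fun i => gaussianReal 0 (v i)).map (a + ·) =
      Measure.pi fun i => gaussianReal (a i) (v i) := by
    rw [show (a + ·) = fun (y : ι → ℝ) i => a i + y i from rfl,
      Measure.pi_map_pi fun i => (measurable_const_add (a i)).aemeasurable]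
    simp_rw [gaussianReal_map_const_add, zero_add]
  have hdens (i : ι) := gaussianReal_eq_withDensity_gaussianReal_zero (a i) (hv i)
  have (i : ι) : SigmaFinite ((gaussianReal 0 (v i)).withDensity
      fun y => ENNReal.ofReal (Real.exp (y / v i * a i - a i ^ 2 / (2 * v i)))) :=
    hdens i ▸ inferInstance
  rw [hmap, funext hdens, measure_pi_withDensity _ fun i => by fun_prop]
  congr 1
  ext y
  rw [gaussianScore_apply, ← Finset.sum_sub_distrib, Real.exp_sum,
    ENNReal.ofReal_prod_of_nonneg fun i _ => (Real.exp_pos _).le]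

/-- The Cameron–Martin formula: once the factor independent of `y` is taken out of the integral,
the rest is a Laplace transform in `a`. -/
lemma integral_add_pi_gaussianReal (hv : ∀ i, v i ≠ 0) (a : ι → ℝ) {ψ : (ι → ℝ) → ℝ}
    (hψ : Measurable ψ) :
    ∫ y, ψ (a + y) ∂(Measure.pi fun i => gaussianReal 0 (v i)) =
      Real.exp (-∑ i, a i ^ 2 / (2 * v i)) *
        ∫ y, ψ y * Real.exp (gaussianScore v y a) ∂(Measure.pi fun i => gaussianReal 0 (v i)) := by
  rw [← integral_map (f := ψ) (φ := (a + ·)) (by fun_prop) hψ.aestronglyMeasurable,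
    map_add_pi_gaussianReal hv, integral_withDensity_eq_integral_toReal_smul (by fun_prop)
      (Eventually.of_forall fun _ => ENNReal.ofReal_lt_top), ← integral_const_mul]
  refine integral_congr_ae (Eventually.of_forall fun y => ?_)
  simp only [smul_eq_mul]
  rw [ENNReal.toReal_ofReal (Real.exp_pos _).le, sub_eq_neg_add, Real.exp_add]
  ring

end CameronMartin

/-! ### Differentiation of Gaussian integrals -/

section Derivative

section ExponentialFamily

variable {Ω E : Type*} [MeasurableSpace Ω] {μ : Measure Ω} [NormedAddCommGroup E]
  [NormedSpace ℝ E] {X : Ω → E →L[ℝ] ℝ} {ψ : Ω → ℝ} {C : ℝ}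

lemma integrable_smul_of_integrable_exp_norm (hψ : AEStronglyMeasurable ψ μ)
    (hC : ∀ ω, |ψ ω| ≤ C) (hX : AEStronglyMeasurable X μ)
    (hexp : Integrable (fun ω => Real.exp ‖X ω‖) μ) : Integrable (fun ω => ψ ω • X ω) μ := by
  refine (hexp.const_mul C).mono' (hψ.smul hX) (Eventually.of_forall fun ω => ?_)
  rw [norm_smul]
  exact mul_le_mul (hC ω) (by linarith [Real.add_one_le_exp ‖X ω‖]) (norm_nonneg _)
    ((abs_nonneg _).trans (hC ω))

theorem hasFDerivAt_integral_mul_exp_zero (hψ : AEStronglyMeasurable ψ μ)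
    (hC : ∀ ω, |ψ ω| ≤ C) (hX : AEStronglyMeasurable X μ)
    (hexp : Integrable (fun ω => Real.exp (2 * ‖X ω‖)) μ) :
    HasFDerivAt (fun a => ∫ ω, ψ ω * Real.exp (X ω a) ∂μ) (∫ ω, ψ ω • X ω ∂μ) 0 := by
  let F' (a : E) (ω : Ω) : E →L[ℝ] ℝ := (ψ ω * Real.exp (X ω a)) • X ω
  have hmeas (a : E) : AEStronglyMeasurable (fun ω => ψ ω * Real.exp (X ω a)) μ :=
    hψ.mul (Real.continuous_exp.comp_aestronglyMeasurable (hX.apply_continuousLinearMap a))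
  have hC_nonneg (ω : Ω) : 0 ≤ C := (abs_nonneg _).trans (hC ω)
  have hint : Integrable (fun ω => ψ ω * Real.exp (X ω 0)) μ := by
    refine (hexp.const_mul C).mono' (hmeas 0) (Eventually.of_forall fun ω => ?_)
    rw [map_zero, Real.exp_zero, mul_one]
    exact (hC ω).trans (le_mul_of_one_le_right (hC_nonneg ω) (Real.one_le_exp (by positivity)))
  have hbound (ω : Ω) (a : E) (ha : a ∈ Metric.ball (0 : E) 1) :
      ‖F' a ω‖ ≤ C * Real.exp (2 * ‖X ω‖) := by
    have hXa : X ω a ≤ ‖X ω‖ := (le_abs_self _).trans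
      ((X ω).unit_le_opNorm a (mem_ball_zero_iff.1 ha).le)
    calc ‖F' a ω‖ = |ψ ω| * Real.exp (X ω a) * ‖X ω‖ := by
          rw [norm_smul, norm_mul, Real.norm_eq_abs, Real.norm_eq_abs, Real.abs_exp]
      _ ≤ C * Real.exp ‖X ω‖ * Real.exp ‖X ω‖ := by
          gcongr
          · exact mul_nonneg (hC_nonneg ω) (Real.exp_pos _).le
          · exact hC_nonneg ω
          · exact hC ω
          · linarith [Real.add_one_le_exp ‖X ω‖]
      _ = C * Real.exp (2 * ‖X ω‖) := by rw [mul_assoc, ← Real.exp_add, two_mul]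
  have hderiv (ω : Ω) (a : E) :
      HasFDerivAt (fun a => ψ ω * Real.exp (X ω a)) (F' a ω) a := by
    simpa only [F', smul_smul] using ((X ω).hasFDerivAt.exp.const_mul (ψ ω))
  have hmain := hasFDerivAt_integral_of_dominated_of_fderiv_le (μ := μ) (F' := F')
    (Metric.ball_mem_nhds 0 one_pos) (Eventually.of_forall hmeas) hint
    ((hmeas 0).smul hX) (Eventually.of_forall hbound) (hexp.const_mul C)
    (Eventually.of_forall fun ω a _ => hderiv ω a)
  simpa only [F', map_zero, Real.exp_zero, mul_one] using hmain

end ExponentialFamily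

section Translation

variable {Ω ι : Type*} [MeasurableSpace Ω] {P : Measure Ω} [Fintype ι] {v : ι → ℝ≥0}
  {ψ : (ι → ℝ) → ℝ} {C : ℝ}

lemma hasFDerivAt_integral_add_pi_gaussianReal_zero (hv : ∀ i, v i ≠ 0) (hψ : Measurable ψ)
    (hC : ∀ y, |ψ y| ≤ C) :
    HasFDerivAt (fun a => ∫ y, ψ (a + y) ∂(Measure.pi fun i => gaussianReal 0 (v i)))
      (∫ y, ψ y • gaussianScore v y ∂(Measure.pi fun i => gaussianReal 0 (v i))) 0 := by
  simp_rw [fun a => integral_add_pi_gaussianReal hv a hψ]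
  have hsq (i : ι) : HasFDerivAt (fun a : ι → ℝ => a i ^ 2 / (2 * (v i : ℝ)))
      (0 : (ι → ℝ) →L[ℝ] ℝ) 0 := by
    simpa [div_eq_mul_inv] using
      ((hasFDerivAt_apply (𝕜 := ℝ) i (0 : ι → ℝ)).pow 2).mul_const (2 * (v i : ℝ))⁻¹
  have hfactor : HasFDerivAt (fun a : ι → ℝ => Real.exp (-∑ i, a i ^ 2 / (2 * (v i : ℝ))))
      (0 : (ι → ℝ) →L[ℝ] ℝ) 0 := by
    have hsum : HasFDerivAt (fun a : ι → ℝ => ∑ i, a i ^ 2 / (2 * (v i : ℝ)))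
        (∑ _i : ι, (0 : (ι → ℝ) →L[ℝ] ℝ)) 0 := HasFDerivAt.fun_sum fun i _ => hsq i
    simpa only [Finset.sum_const_zero, neg_zero, smul_zero] using hsum.fun_neg.exp
  have hintegral := hasFDerivAt_integral_mul_exp_zero hψ.aestronglyMeasurable hC
    (by fun_prop : AEStronglyMeasurable (gaussianScore v) _)
    (integrable_exp_norm_gaussianScore v 2)
  simpa using hfactor.fun_mul hintegral

variable {J : Ω → ι → ℝ}

lemma integrable_smul_gaussianScore
    (hJ : HasLaw J (Measure.pi fun i => gaussianReal 0 (v i)) P) (hψ : Measurable ψ)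
    (hC : ∀ y, |ψ y| ≤ C) : Integrable (fun ω => ψ (J ω) • gaussianScore v (J ω)) P := by
  have hexp : Integrable (fun y => Real.exp ‖gaussianScore v y‖)
      (Measure.pi fun i => gaussianReal 0 (v i)) := by
    simpa only [one_mul] using integrable_exp_norm_gaussianScore v 1
  have h := integrable_smul_of_integrable_exp_norm hψ.aestronglyMeasurable hC
    (by fun_prop : AEStronglyMeasurable (gaussianScore v) _) hexp
  rw [← hJ.map_eq] at h
  exact h.comp_aemeasurable hJ.aemeasurable

theorem hasFDerivAt_integral_add_of_hasLaw
    (hJ : HasLaw J (Measure.pi fun i => gaussianReal 0 (v i)) P) (hv : ∀ i, v i ≠ 0)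
    (hψ : Measurable ψ) (hC : ∀ y, |ψ y| ≤ C) (a : ι → ℝ) :
    HasFDerivAt (fun a => ∫ ω, ψ (a + J ω) ∂P)
      (∫ ω, ψ (a + J ω) • gaussianScore v (J ω) ∂P) a := by
  have hmeas (b : ι → ℝ) : Measurable fun y => ψ (b + y) := hψ.comp (by fun_prop)
  have hderiv := hasFDerivAt_integral_add_pi_gaussianReal_zero hv (hmeas a) fun y => hC (a + y)
  have hlaw (b : ι → ℝ) : ∫ ω, ψ (b + J ω) ∂P =
      ∫ y, ψ (b + y) ∂(Measure.pi fun i => gaussianReal 0 (v i)) :=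
    hJ.integral_comp (hmeas b).aestronglyMeasurable
  have hscore : ∫ ω, ψ (a + J ω) • gaussianScore v (J ω) ∂P =
      ∫ y, ψ (a + y) • gaussianScore v y ∂(Measure.pi fun i => gaussianReal 0 (v i)) :=
    hJ.integral_comp (f := fun y => ψ (a + y) • gaussianScore v y)
      ((hmeas a).aestronglyMeasurable.smul (by fun_prop))
  rw [← sub_self a, ← hasFDerivAt_comp_sub] at hderiv
  simpa only [hlaw, hscore, ← add_assoc, add_sub_cancel] using hderiv

end Translation
end Derivative

/-! ### Ornstein–Uhlenbeck processes with diagonal coefficients -/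

section VariationOfConstants

lemma pathIntegral_exp_mul_sub (μ : ℝ) (y : ℝ≥0 → ℝ) (t : ℝ≥0) :
    pathIntegral (fun s => Real.exp (μ * (t - s))) y t =
      y t - y 0 + ∫ s in (0 : ℝ)..t, μ * Real.exp (μ * (t - s)) * (y s.toNNReal - y 0) := by
  have hderiv (s : ℝ) : deriv (fun s => Real.exp (μ * (t - s))) s =
      -(μ * Real.exp (μ * (t - s))) := by
    have h := (((hasDerivAt_id s).const_sub (t : ℝ)).const_mul μ).exp
    simpa [mul_comm] using h.deriv
  simp [pathIntegral, hderiv]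

variable {Ω ι : Type*} [MeasurableSpace Ω] [Fintype ι] {P : Measure Ω} {N : ℕ}
  {A S : EuclideanSpace ℝ (Fin N) →L[ℝ] EuclideanSpace ℝ (Fin N)}
  {b : ι → EuclideanSpace ℝ (Fin N)} {μ σ : ι → ℝ}
  {x : EuclideanSpace ℝ (Fin N)} {X : ℝ≥0 → Ω → EuclideanSpace ℝ (Fin N)}
  {Y : ι → ℝ≥0 → Ω → ℝ}

lemma isCadlag_sum_smul {y : ι → ℝ≥0 → ℝ} (hy : ∀ i, IsCadlag (y i)) :
    IsCadlag fun t => ∑ i, y i t • b i :=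
  IsCadlag.sum _ fun i _ => (hy i).continuous_comp (φ := fun r : ℝ => r • b i) (by fun_prop)

lemma IsOUSolution.ae_eq_exp_add_sum_pathIntegral
    (hX : IsOUSolution P A S (fun t ω => ∑ i, Y i t ω • b i) x X)
    (hA : ∀ i, A (b i) = μ i • b i) (hS : ∀ i, S (b i) = σ i • b i)
    (hY : ∀ i, ∀ᵐ ω ∂P, IsCadlag fun t => Y i t ω) :
    ∀ᵐ ω ∂P, ∀ t : ℝ≥0, X t ω = NormedSpace.exp ((t : ℝ) • A) x + ∑ i,
      (σ i * pathIntegral (fun s => Real.exp (μ i * (t - s))) (fun s => Y i s ω) t) • b i := by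
  have hcad : ∀ᵐ ω ∂P, ∀ i, IsCadlag fun t => Y i t ω := ae_all_iff.2 hY
  filter_upwards [hcad, hX.ae_eq (.of_mildPath (hcad.mono fun ω hω => isCadlag_sum_smul hω))]
    with ω hω hXω t
  have hforcing (s : ℝ≥0) : S (∑ i, Y i s ω • b i - ∑ i, Y i 0 ω • b i) =
      ∑ i, (σ i * (Y i s ω - Y i 0 ω)) • b i := by
    simp_rw [← Finset.sum_sub_distrib, ← sub_smul, map_sum, map_smul, hS, smul_smul, mul_comm]
  have hc (i : ι) : IsCadlag fun s => σ i * (Y i s ω - Y i 0 ω) :=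
    (hω i).continuous_comp (φ := fun r => σ i * (r - Y i 0 ω)) (by fun_prop)
  simp_rw [hXω t, hforcing, mildPath_sum_smul_of_eigenvectors hA hc, pathIntegral_exp_mul_sub,
    mul_add, mul_left_comm _ (σ _), intervalIntegral.integral_const_mul]

theorem IsStochIntegral.of_exp_mul_sub [IsFiniteMeasure P] {Y : ℝ≥0 → Ω → ℝ}
    (hYm : ∀ s, AEMeasurable (Y s) P) (hY : ∀ᵐ ω ∂P, IsCadlag fun s => Y s ω) (μ : ℝ) (t : ℝ≥0) :
    IsStochIntegral P (fun s => Real.exp (μ * ((t : ℝ) - s))) Y t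
      fun ω => pathIntegral (fun s => Real.exp (μ * (t - s))) (fun s => Y s ω) t :=
  .of_isCadlag hYm hY (f := fun s => Real.exp (μ * (t - s))) (by fun_prop) t

theorem IsOUSolution.ae_eq_exp_add_sum [IsFiniteMeasure P] {t : ℝ≥0} {I : ι → Ω → ℝ}
    (hX : IsOUSolution P A S (fun t ω => ∑ i, Y i t ω • b i) x X)
    (hA : ∀ i, A (b i) = μ i • b i) (hS : ∀ i, S (b i) = σ i • b i)
    (hYm : ∀ i s, AEMeasurable (Y i s) P) (hY : ∀ i, ∀ᵐ ω ∂P, IsCadlag fun t => Y i t ω)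
    (hI : ∀ i, IsStochIntegral P (fun s => Real.exp (μ i * ((t : ℝ) - s))) (Y i) t (I i)) :
    ∀ᵐ ω ∂P, X t ω = NormedSpace.exp ((t : ℝ) • A) x + ∑ i, (σ i * I i ω) • b i := by
  have hI' := ae_all_iff.2 fun i => (hI i).ae_eq (.of_exp_mul_sub (hYm i) (hY i) (μ i) t)
  filter_upwards [hX.ae_eq_exp_add_sum_pathIntegral hA hS hY, hI'] with ω hω hIω
  simp_rw [hω t, hIω]

lemma ae_isCadlag_comp_timeChange {B : ℝ≥0 → Ω → ℝ} (hB : IsBrownianReal B P) (ℓ : TimeChange) :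
    ∀ᵐ ω ∂P, IsCadlag fun t => B (ℓ t) ω := by
  filter_upwards [hB.cont] with ω hω using ℓ.cadlag'.continuous_comp hω

end VariationOfConstants

section Covariance

lemma toEuclideanCLM_symm_eq_sum_smul_vecMulVec {ι κ : Type*} [Fintype ι] [Fintype κ]
    [DecidableEq κ] (e : OrthonormalBasis ι ℝ (EuclideanSpace ℝ κ))
    {T : EuclideanSpace ℝ κ →L[ℝ] EuclideanSpace ℝ κ} {c : ι → ℝ}
    (hT : ∀ i, T (e i) = c i • e i) :
    (Matrix.toEuclideanCLM (n := κ) (𝕜 := ℝ)).symm T =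
      ∑ i, c i • Matrix.vecMulVec (e i).ofLp (e i).ofLp := by
  ext j k
  have hentry (M : Matrix κ κ ℝ) : M j k =
      Matrix.toEuclideanCLM (n := κ) (𝕜 := ℝ) M (EuclideanSpace.single k 1) j := by simp
  refine (hentry _).trans ?_
  rw [StarAlgEquiv.apply_symm_apply, ← e.sum_repr' (EuclideanSpace.single k 1)]
  simp [hT, Matrix.sum_apply, Matrix.vecMulVec_apply, EuclideanSpace.inner_single_right,
    mul_comm, mul_assoc]

variable {N : ℕ} (e : OrthonormalBasis (Fin N) ℝ (EuclideanSpace ℝ (Fin N)))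
  {A Q : EuclideanSpace ℝ (Fin N) →L[ℝ] EuclideanSpace ℝ (Fin N)} {μ σ : Fin N → ℝ}

lemma ouCovariance_eq_sum_smul_vecMulVec (hA : ∀ n, A (e n) = μ n • e n)
    (hQ : ∀ n, Q (e n) = (σ n ^ 2) • e n) (ℓ : TimeChange) (t : ℝ≥0) :
    ouCovariance A Q ℓ t = ∑ n, ℓ.integral (fun s => Real.exp (μ n * ((t : ℝ) - s)) ^ 2) t •
      Matrix.vecMulVec (σ n • e n).ofLp (σ n • e n).ofLp := by
  have hdiag (s : ℝ≥0) (n : Fin N) : (NormedSpace.exp ((2 * ((t : ℝ) - s)) • A) * Q) (e n) =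
      (Real.exp (μ n * ((t : ℝ) - s)) ^ 2 * σ n ^ 2) • e n := by
    rw [mul_apply_eq_comp, hQ, map_smul, exp_smul_apply_of_eigenvector (hA n), smul_smul,
      ← Real.exp_nat_mul]
    push_cast
    ring_nf
  ext i j
  simp only [ouCovariance, Matrix.of_apply, Matrix.sum_apply, Matrix.smul_apply,
    TimeChange.integral, fun s => toEuclideanCLM_symm_eq_sum_smul_vecMulVec e (hdiag s),
    Matrix.vecMulVec_apply, PiLp.smul_apply, smul_eq_mul]
  rw [integral_finsetSum _ fun n _ => ℓ.integrableOn_of_continuous (by fun_prop) t]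
  refine Finset.sum_congr rfl fun n _ => ?_
  rw [← integral_mul_const]
  congr with s
  ring

variable {Ω : Type*} [MeasurableSpace Ω] {P : Measure Ω} {ℓ : TimeChange} {t : ℝ≥0}
  {J : Ω → Fin N → ℝ}

theorem hasLaw_multivariateGaussian_ouCovariance (hA : ∀ n, A (e n) = μ n • e n)
    (hQ : ∀ n, Q (e n) = (σ n ^ 2) • e n)
    (hJ : HasLaw J (Measure.pi fun n => gaussianReal 0
      (ℓ.integral (fun s => Real.exp (μ n * ((t : ℝ) - s)) ^ 2) t).toNNReal) P)
    (m : EuclideanSpace ℝ (Fin N)) :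
    HasLaw (fun ω => m + ∑ n, (σ n * J ω n) • e n)
      (multivariateGaussian m (ouCovariance A Q ℓ t)) P := by
  have hcov : ouCovariance A Q ℓ t = ∑ n,
      ((ℓ.integral (fun s => Real.exp (μ n * ((t : ℝ) - s)) ^ 2) t).toNNReal : ℝ) •
        Matrix.vecMulVec (σ n • e n).ofLp (σ n • e n).ofLp := by
    simp_rw [Real.coe_toNNReal _ (ℓ.integral_nonneg (fun _ => sq_nonneg _) t)]
    exact ouCovariance_eq_sum_smul_vecMulVec e hA hQ ℓ t
  rw [hcov, ← map_pi_gaussianReal_add_sum_smul]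
  simp_rw [mul_comm (σ _), ← smul_smul]
  exact HasLaw.comp (Y := fun y : Fin N → ℝ => m + ∑ n, y n • σ n • e n)
    ⟨Measurable.aemeasurable (by fun_prop), rfl⟩ hJ

end Covariance

section GradientFormula

variable {Ω ι E : Type*} [MeasurableSpace Ω] {P : Measure Ω} [Fintype ι] [NormedAddCommGroup E]
  [InnerProductSpace ℝ E] (e : OrthonormalBasis ι ℝ E) {T : E →L[ℝ] E} {d σ : ι → ℝ}

/-- The coefficients `(d n / σ n * ⟪e n, z⟫)` that `T z` has with respect to the vectors
`σ n • e n`, where `T (e n) = d n • e n`. Moving `z` thus amounts to translating the coefficients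
`y` of the noise `∑ n, (σ n * y n) • e n`. -/
noncomputable def noiseShift (d σ : ι → ℝ) : E →L[ℝ] (ι → ℝ) :=
  ContinuousLinearMap.pi fun n => (d n / σ n) • innerSL ℝ (e n)

lemma noiseShift_apply (d σ : ι → ℝ) (z : E) (n : ι) :
    noiseShift e d σ z n = d n / σ n * inner ℝ (e n) z := by
  simp [noiseShift]

lemma add_sum_smul_eq_sum_noiseShift_add (hT : ∀ n, T (e n) = d n • e n) (hσ : ∀ n, σ n ≠ 0)
    (z : E) (y : ι → ℝ) :
    T z + ∑ n, (σ n * y n) • e n = ∑ n, (σ n * (noiseShift e d σ z + y) n) • e n := by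
  conv_lhs => rw [← e.sum_repr' z]
  simp_rw [map_sum, map_smul, hT, smul_smul, ← Finset.sum_add_distrib, ← add_smul, Pi.add_apply,
    noiseShift_apply, mul_add, ← mul_assoc, mul_div_cancel₀ _ (hσ _), mul_comm]

lemma gaussianScore_noiseShift (v : ι → ℝ≥0) (d σ y : ι → ℝ) (h : E) :
    gaussianScore v y (noiseShift e d σ h) =
      ∑ n, 1 / σ n * (d n * inner ℝ h (e n) / v n) * y n := by
  rw [gaussianScore_apply]
  refine Finset.sum_congr rfl fun n _ => ?_
  rw [noiseShift_apply, real_inner_comm]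
  ring

variable [CompleteSpace E] [MeasurableSpace E] [BorelSpace E] {v : ι → ℝ≥0} {J : Ω → ι → ℝ}
  {Z : E → Ω → E} {φ : E → ℝ} {C : ℝ}

theorem differentiableAt_integral_and_inner_gradient_eq (hT : ∀ n, T (e n) = d n • e n)
    (hσ : ∀ n, σ n ≠ 0) (hv : ∀ n, v n ≠ 0)
    (hJ : HasLaw J (Measure.pi fun n => gaussianReal 0 (v n)) P)
    (hZ : ∀ z, ∀ᵐ ω ∂P, Z z ω = T z + ∑ n, (σ n * J ω n) • e n)
    (hφ : Measurable φ) (hC : ∀ y, |φ y| ≤ C) (x : E) :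
    DifferentiableAt ℝ (fun z => ∫ ω, φ (Z z ω) ∂P) x ∧ ∀ h,
      Integrable (fun ω => φ (Z x ω) *
        ∑ n, 1 / σ n * (d n * inner ℝ h (e n) / v n) * J ω n) P ∧
      inner ℝ (gradient (fun z => ∫ ω, φ (Z z ω) ∂P) x) h =
        ∫ ω, φ (Z x ω) * ∑ n, 1 / σ n * (d n * inner ℝ h (e n) / v n) * J ω n ∂P := by
  let c := noiseShift e d σ
  let ψ (y : ι → ℝ) : ℝ := φ (∑ n, (σ n * y n) • e n)
  have hψ : Measurable ψ := hφ.comp (by fun_prop : Continuous _).measurable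
  have hφψ (z : E) : ∀ᵐ ω ∂P, φ (Z z ω) = ψ (c z + J ω) := by
    filter_upwards [hZ z] with ω hω
    rw [hω, add_sum_smul_eq_sum_noiseShift_add e hT hσ]
  have hint : Integrable (fun ω => ψ (c x + J ω) • gaussianScore v (J ω)) P :=
    integrable_smul_gaussianScore (ψ := fun y => ψ (c x + y)) hJ (by fun_prop) fun y => hC _
  have hderiv : HasFDerivAt (fun z => ∫ ω, φ (Z z ω) ∂P)
      ((∫ ω, ψ (c x + J ω) • gaussianScore v (J ω) ∂P) ∘L c) x := by
    simp_rw [fun z => integral_congr_ae (hφψ z)]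
    exact (hasFDerivAt_integral_add_of_hasLaw hJ hv hψ (fun y => hC _) (c x)).comp x c.hasFDerivAt
  have hscore (h : E) : ∀ᵐ ω ∂P, (ψ (c x + J ω) • gaussianScore v (J ω)) (c h) =
      φ (Z x ω) * ∑ n, 1 / σ n * (d n * inner ℝ h (e n) / v n) * J ω n := by
    filter_upwards [hφψ x] with ω hω
    rw [smul_apply, smul_eq_mul, hω, gaussianScore_noiseShift]
  refine ⟨hderiv.differentiableAt, fun h => ⟨?_, ?_⟩⟩
  · exact ((ContinuousLinearMap.apply ℝ ℝ (c h)).integrable_comp hint).congr (hscore h)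
  · rw [inner_gradient_left, hderiv.fderiv, ContinuousLinearMap.comp_apply,
      ContinuousLinearMap.integral_apply hint, integral_congr_ae (hscore h)]

end GradientFormula

lemma exp_neg_mul_sq (a b : ℝ) : Real.exp (-a * b) ^ 2 = Real.exp (-2 * a * b) := by
  rw [← Real.exp_nat_mul]
  push_cast
  ring_nf

theorem mainTheorem4_general {Ω : Type*} [MeasurableSpace Ω] (P : Measure Ω)
    [IsProbabilityMeasure P] (N : ℕ) (e : OrthonormalBasis (Fin N) ℝ (EuclideanSpace ℝ (Fin N)))
    (lam σ : Fin N → ℝ)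
    (A Q sqrtQ : EuclideanSpace ℝ (Fin N) →L[ℝ] EuclideanSpace ℝ (Fin N))
    (hA : ∀ n, A (e n) = (-lam n) • e n) (hQ : ∀ n, Q (e n) = (σ n ^ 2) • e n)
    (hsqrtQ : ∀ n, sqrtQ (e n) = σ n • e n)
    (β : Fin N → ℝ≥0 → Ω → ℝ) (hβ : ∀ n, IsBrownianReal (β n) P)
    (hβ_indep : iIndepFun (fun n ω => fun t : ℝ≥0 => β n t ω) P)
    (W : ℝ≥0 → Ω → EuclideanSpace ℝ (Fin N)) (hW : ∀ t ω, W t ω = ∑ n, β n t ω • e n)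
    (ℓ : TimeChange)
    (I : Fin N → ℝ≥0 → Ω → ℝ)
    (hI : ∀ n (t : ℝ≥0), I n t = stochIntegral P (fun s => Real.exp (-lam n * ((t : ℝ) - s)))
      (fun s => β n (ℓ s)) t) :
    (∀ x, ∃ X, IsOUSolution P A sqrtQ (fun t => W (ℓ t)) x X) ∧
    (∀ x X X', IsOUSolution P A sqrtQ (fun t => W (ℓ t)) x X →
      IsOUSolution P A sqrtQ (fun t => W (ℓ t)) x X' → ∀ᵐ ω ∂P, ∀ t, X t ω = X' t ω) ∧
    (∀ n (t : ℝ≥0), IsStochIntegral P (fun s => Real.exp (-lam n * ((t : ℝ) - s)))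
      (fun s => β n (ℓ s)) t (I n t)) ∧
    ∀ Z : EuclideanSpace ℝ (Fin N) → ℝ≥0 → Ω → EuclideanSpace ℝ (Fin N),
      (∀ x, IsOUSolution P A sqrtQ (fun t => W (ℓ t)) x (Z x)) →
      (∀ x t, ∀ᵐ ω ∂P, Z x t ω = NormedSpace.exp ((t : ℝ) • A) x + ∑ n, (σ n * I n t ω) • e n) ∧
      (∀ x t, HasLaw (Z x t)
        (multivariateGaussian (NormedSpace.exp ((t : ℝ) • A) x) (ouCovariance A Q ℓ t)) P) ∧
      ((∀ n, σ n ≠ 0) → ∀ t : ℝ≥0, 0 < t → ∀ φ : EuclideanSpace ℝ (Fin N) → ℝ,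
        Measurable φ → (∃ C : ℝ, ∀ y, |φ y| ≤ C) → ∀ x,
          DifferentiableAt ℝ (fun y => ∫ ω, φ (Z y t ω) ∂P) x ∧
          ∀ h : EuclideanSpace ℝ (Fin N),
            Integrable (fun ω => φ (Z x t ω) * ∑ n, 1 / σ n *
              (Real.exp (-lam n * t) * inner ℝ h (e n) /
                ℓ.integral (fun s => Real.exp (-2 * lam n * ((t : ℝ) - s))) t) * I n t ω) P ∧
            inner ℝ (gradient (fun y => ∫ ω, φ (Z y t ω) ∂P) x) h =
              ∫ ω, φ (Z x t ω) * ∑ n, 1 / σ n *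
                (Real.exp (-lam n * t) * inner ℝ h (e n) /
                  ℓ.integral (fun s => Real.exp (-2 * lam n * ((t : ℝ) - s))) t) * I n t ω ∂P) := by
  obtain rfl : W = fun t ω => ∑ n, β n t ω • e n := funext₂ hW
  have hcad (n) := ae_isCadlag_comp_timeChange (hβ n) ℓ
  have hmeas (n) (s : ℝ≥0) : AEMeasurable (β n (ℓ s)) P := (hβ n).aemeasurable _
  have hint (n) (t : ℝ≥0) : IsStochIntegral P (fun s => Real.exp (-lam n * ((t : ℝ) - s)))
      (fun s => β n (ℓ s)) t (I n t) :=
    hI n t ▸ (IsStochIntegral.of_exp_mul_sub (hmeas n) (hcad n) _ t).isStochIntegral_stochIntegral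
  have hlaw (t : ℝ≥0) := IsStochIntegral.hasLaw_pi_gaussianReal
    (fun n => (hβ n).toIsPreBrownianReal) hβ_indep (fun n => by fun_prop) fun n => hint n t
  refine ⟨fun x => ⟨_, .of_mildPath ((ae_all_iff.2 hcad).mono fun ω => isCadlag_sum_smul)⟩,
    fun x X X' => IsOUSolution.ae_eq, hint, fun Z hZ => ?_⟩
  have hvar (x) (t : ℝ≥0) : ∀ᵐ ω ∂P,
      Z x t ω = NormedSpace.exp ((t : ℝ) • A) x + ∑ n, (σ n * I n t ω) • e n :=
    (hZ x).ae_eq_exp_add_sum hA hsqrtQ hmeas hcad fun n => hint n t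
  refine ⟨hvar, fun x t => ?_, fun hσ t ht φ hφ ⟨C, hC⟩ x => ?_⟩
  · exact (hasLaw_multivariateGaussian_ouCovariance e hA hQ (hlaw t) _).congr (hvar x t)
  have hT (n) : NormedSpace.exp ((t : ℝ) • A) (e n) = Real.exp (-lam n * t) • e n := by
    rw [exp_smul_apply_of_eigenvector (hA n), mul_comm]
  have hv (n) : (ℓ.integral (fun s => Real.exp (-lam n * ((t : ℝ) - s)) ^ 2) t).toNNReal ≠ 0 :=
    (Real.toNNReal_pos.2 (ℓ.integral_pos (by fun_prop) (fun s => by positivity) ht)).ne'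
  simpa only [exp_neg_mul_sq,
    Real.coe_toNNReal _ (ℓ.integral_nonneg (fun _ => Real.exp_nonneg _) t)]
    using differentiableAt_integral_and_inner_gradient_eq e hT hσ hv (hlaw t) (fun z => hvar z t)
      hφ hC x

theorem mainTheorem4 {Ω : Type*} [MeasurableSpace Ω] (P : Measure Ω) [IsProbabilityMeasure P]
    (N : ℕ) (e : OrthonormalBasis (Fin N) ℝ (EuclideanSpace ℝ (Fin N)))
    -- `A`, `Q` and the nonnegative root of `Q`, given by their eigenvalues on the common basis `e`
    (lam σ : Fin N → ℝ) (hlam : ∀ n, 0 < lam n) (hσ : ∀ n, 0 ≤ σ n)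
    (A Q sqrtQ : EuclideanSpace ℝ (Fin N) →L[ℝ] EuclideanSpace ℝ (Fin N))
    (hA : ∀ n, A (e n) = (-lam n) • e n) (hQ : ∀ n, Q (e n) = (σ n ^ 2) • e n)
    (hsqrtQ : ∀ n, sqrtQ (e n) = σ n • e n)
    -- independent Brownian motions, and `W = ∑ n, β n • e n`
    (β : Fin N → ℝ≥0 → Ω → ℝ) (hβ_meas : ∀ n t, Measurable (β n t))
    (hβ : ∀ n, IsBrownianReal (β n) P)
    (hβ_indep : iIndepFun (fun n ω => fun t : ℝ≥0 => β n t ω) P)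
    (W : ℝ≥0 → Ω → EuclideanSpace ℝ (Fin N)) (hW : ∀ t ω, W t ω = ∑ n, β n t ω • e n)
    (ℓ : TimeChange)
    -- `I n t = ∫_0^t e^{-lam n (t - s)} dβ^n_{ℓ_s}`
    (I : Fin N → ℝ≥0 → Ω → ℝ)
    (hI : ∀ n (t : ℝ≥0), I n t = stochIntegral P (fun s => Real.exp (-lam n * ((t : ℝ) - s)))
      (fun s => β n (ℓ s)) t) :
    -- the SDE has a solution for every starting point, unique up to indistinguishability
    (∀ x, ∃ X, IsOUSolution P A sqrtQ (fun t => W (ℓ t)) x X) ∧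
    (∀ x X X', IsOUSolution P A sqrtQ (fun t => W (ℓ t)) x X →
      IsOUSolution P A sqrtQ (fun t => W (ℓ t)) x X' → ∀ᵐ ω ∂P, ∀ t, X t ω = X' t ω) ∧
    -- the stochastic integrals exist
    (∀ n (t : ℝ≥0), IsStochIntegral P (fun s => Real.exp (-lam n * ((t : ℝ) - s)))
      (fun s => β n (ℓ s)) t (I n t)) ∧
    ∀ Z : EuclideanSpace ℝ (Fin N) → ℝ≥0 → Ω → EuclideanSpace ℝ (Fin N),
      (∀ x, IsOUSolution P A sqrtQ (fun t => W (ℓ t)) x (Z x)) →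
      -- variation of constants
      (∀ x t, ∀ᵐ ω ∂P, Z x t ω = NormedSpace.exp ((t : ℝ) • A) x + ∑ n, (σ n * I n t ω) • e n) ∧
      -- the law of the solution
      (∀ x t, HasLaw (Z x t)
        (multivariateGaussian (NormedSpace.exp ((t : ℝ) • A) x) (ouCovariance A Q ℓ t)) P) ∧
      -- smoothing and the derivative formula
      ((∀ n, 0 < σ n) → ∀ t : ℝ≥0, 0 < t → ∀ φ : EuclideanSpace ℝ (Fin N) → ℝ,
        Measurable φ → (∃ C : ℝ, ∀ y, |φ y| ≤ C) → ∀ x,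
          DifferentiableAt ℝ (fun y => ∫ ω, φ (Z y t ω) ∂P) x ∧
          ∀ h : EuclideanSpace ℝ (Fin N),
            Integrable (fun ω => φ (Z x t ω) * ∑ n, 1 / σ n *
              (Real.exp (-lam n * t) * inner ℝ h (e n) /
                ℓ.integral (fun s => Real.exp (-2 * lam n * ((t : ℝ) - s))) t) * I n t ω) P ∧
            inner ℝ (gradient (fun y => ∫ ω, φ (Z y t ω) ∂P) x) h =
              ∫ ω, φ (Z x t ω) * ∑ n, 1 / σ n *
                (Real.exp (-lam n * t) * inner ℝ h (e n) /
                  ℓ.integral (fun s => Real.exp (-2 * lam n * ((t : ℝ) - s))) t) * I n t ω ∂P) := by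
  obtain ⟨hex, huniq, hint, h⟩ :=
    mainTheorem4_general P N e lam σ A Q sqrtQ hA hQ hsqrtQ β hβ hβ_indep W hW ℓ I hI
  exact ⟨hex, huniq, hint, fun Z hZ =>
    (h Z hZ).imp_right (.imp_right fun hderiv hpos => hderiv fun n => (hpos n).ne')⟩
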